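/- Fix a universe; "small" refers to it. Let $C$ be a small set and let $\mathcal{O}$ be a $C$-coloured (non-symmetric) operad in small categories: small categories of operations $\mathcal{O}(i_1,\dots,i_n;j)$ for $n\ge 0$ and $i_1,\dots,i_n,j\in C$, identity operations $1_j\in\mathcal{O}(j;j)$ and composition functors $\gamma$, which are associative and unital. An $\mathcal{O}$-algebra $\mathcal{M}_\bullet$ consists of categories $\mathcal{M}_i$ ($i\in C$) and functors $\mathcal{O}(i_1,\dots,i_n;j)\times\mathcal{M}_{i_1}\times\cdots\times\mathcal{M}_{i_n}\to\mathcal{M}_j$, $(x,m_1,\dots,m_n)\mapsto\otimes_x(m_1,\dots,m_n)$, strictly compatible with $\gamma$ and with the identity operations. A lax morphism $\mathcal{F}_\bullet:\mathcal{C}_\bullet\to\mathcal{M}_\bullet$ of $\mathcal{O}$-algebras consists of functors $\mathcal{F}_i:\mathcal{C}_i\to\mathcal{M}_i$ and maps $\varphi(x,c_1,\dots,c_n):\otimes_x(\mathcal{F}_{i_1}c_1,\dots,\mathcal{F}_{i_n}c_n)\to\mathcal{F}_j(\otimes_x(c_1,\dots,c_n))$, natural in $(x,c_1,\dots,c_n)$,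 such that $\varphi(1_j,c)=\mathrm{id}$ and $$\varphi(\gamma(x;x_1,\dots,x_n),d_{1,1},\dots,d_{n,k_n})=\varphi(x,c_1,\dots,c_n)\circ\otimes_x(\varphi_1,\dots,\varphi_n),$$ where $c_a=\otimes_{x_a}(d_{a,1},\dots,d_{a,k_a})$ and $\varphi_a=\varphi(x_a,d_{a,1},\dots,d_{a,k_a})$. A morphism of lax morphisms $\mathcal{F}_\bullet\to\mathcal{F}'_\bullet$ is a family of natural transformations $\sigma_i:\mathcal{F}_i\to\mathcal{F}'_i$ with $\sigma_j\circ\varphi(x,c_\bullet)=\varphi'(x,c_\bullet)\circ\otimes_x(\sigma_{i_1},\dots,\sigma_{i_n})$ for all $x$ and $c_\bullet$. Write $\mathrm{Laxalg}(\mathcal{C}_\bullet,\mathcal{M}_\bullet)$ for the resulting category and $\mathcal{U}:\mathrm{Laxalg}(\mathcal{C}_\bullet,\mathcal{M}_\bullet)\to\prod_{i\in C}\mathrm{Hom}(\mathcal{C}_i,\mathcal{M}_i)$ for the functor that forgets the maps $\varphi$. **Theorem.** Let $\mathcal{M}_\bullet$ be a locally presentable $\mathcal{O}$-algebra, that is,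 every $\mathcal{M}_i$ is a locally presentable category, and for every operation $x\in\mathcal{O}(i_1,\dots,i_n;j)$, every $1\le k\le n$ and all objects $m_l\in\mathcal{M}_{i_l}$ ($l\ne k$) the functor $\otimes_x(m_1,\dots,m_{k-1},-,m_{k+1},\dots,m_n):\mathcal{M}_{i_k}\to\mathcal{M}_j$ preserves all small colimits. Then for every $\mathcal{O}$-algebra $\mathcal{C}_\bullet$ with all $\mathcal{C}_i$ small, the category $\mathrm{Laxalg}(\mathcal{C}_\bullet,\mathcal{M}_\bullet)$ is locally presentable. Moreover $\mathcal{U}$ is monadic, and the induced monad on $\prod_{i\in C}\mathrm{Hom}(\mathcal{C}_i,\mathcal{M}_i)$ is finitary, i.e. preserves small filtered colimits. -/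

import Mathlib

open CategoryTheory CategoryTheory.Limits

universe w v v' u u' u₁ u₁'

/-- The concatenation of a finite sequence of finite (dependent) tuples `d a 0, …, d a (k a - 1)`,
`a = 0, …, n - 1`, indexed lexicographically by `Fin (∑ a, k a)`. -/
abbrev concatTuple {n : ℕ} {k : Fin n → ℕ} {T : ∀ a : Fin n, Fin (k a) → Type*}
    (d : ∀ a b, T a b) (c : Fin (∑ a, k a)) :
    T (finSigmaFinEquiv.symm c).1 (finSigmaFinEquiv.symm c).2 :=
  d (finSigmaFinEquiv.symm c).1 (finSigmaFinEquiv.symm c).2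

/-- The concatenation of a finite sequence of tuples of morphisms. -/
abbrev concatHom {n : ℕ} {k : Fin n → ℕ} {T : ∀ a : Fin n, Fin (k a) → Type*}
    [∀ a b, Category (T a b)] {d d' : ∀ a b, T a b} (f : ∀ a b, d a b ⟶ d' a b)
    (c : Fin (∑ a, k a)) : concatTuple d c ⟶ concatTuple d' c :=
  f (finSigmaFinEquiv.symm c).1 (finSigmaFinEquiv.symm c).2

/-- A (non-symmetric) `Cat`-enriched operad with set of colours `C`, i.e. a `Cat`-enriched
multicategory with set of objects `C`. `Op i j` is the category of operations with inputs
`i 0, …, i (n - 1)` and output `j`; the case `n = 0` is allowed.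

In the associativity and unit laws the two sides have the same input word, but this equality of
words is not definitional, hence the heterogeneous equalities. Each law is stated on objects and on
morphisms, so that it is an equality of functors. -/
structure CatOperad (C : Type w) where
  /-- the categories of operations -/
  Op : ∀ {n : ℕ}, (Fin n → C) → C → Type v
  /-- their category structure -/
  [cat : ∀ {n : ℕ} (i : Fin n → C) (j : C), Category.{v'} (Op i j)]
  /-- the identity operations -/
  one : ∀ j : C, Op (fun _ : Fin 1 => j) j
  /-- the composition (substitution) functors -/
  comp : ∀ {n : ℕ} (i : Fin n → C) (j : C) {k : Fin n → ℕ} (h : ∀ a, Fin (k a) → C),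
    Op i j × (∀ a, Op (h a) (i a)) ⥤ Op (concatTuple h) j
  one_comp_obj : ∀ {n : ℕ} (i : Fin n → C) (j : C) (x : Op i j),
    HEq ((comp (fun _ : Fin 1 => j) j (fun _ => i)).obj (one j, fun _ => x)) x
  one_comp_map : ∀ {n : ℕ} (i : Fin n → C) (j : C) {x x' : Op i j} (p : x ⟶ x'),
    HEq ((comp (fun _ : Fin 1 => j) j (fun _ => i)).map
      (Prod.mkHom (𝟙 (one j)) (fun _ => p) :
        ((one j, fun _ => x) : Op (fun _ : Fin 1 => j) j × (Fin 1 → Op i j)) ⟶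
          (one j, fun _ => x'))) p
  comp_one_obj : ∀ {n : ℕ} (i : Fin n → C) (j : C) (x : Op i j),
    HEq ((comp i j (fun a (_ : Fin 1) => i a)).obj (x, fun a => one (i a))) x
  comp_one_map : ∀ {n : ℕ} (i : Fin n → C) (j : C) {x x' : Op i j} (p : x ⟶ x'),
    HEq ((comp i j (fun a (_ : Fin 1) => i a)).map
      (Prod.mkHom p (fun a => 𝟙 (one (i a))) :
        ((x, fun a => one (i a)) : Op i j × (∀ a, Op (fun _ : Fin 1 => i a) (i a))) ⟶
          (x', fun a => one (i a)))) p
  assoc_obj : ∀ {n : ℕ} (i : Fin n → C) (j : C) {k : Fin n → ℕ} (h : ∀ a, Fin (k a) → C)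
    {r : ∀ a, Fin (k a) → ℕ} (g : ∀ a b, Fin (r a b) → C)
    (x : Op i j) (y : ∀ a, Op (h a) (i a)) (z : ∀ a b, Op (g a b) (h a b)),
    HEq ((comp (concatTuple h) j (concatTuple g)).obj ((comp i j h).obj (x, y), concatTuple z))
      ((comp i j (fun a => concatTuple (g a))).obj
        (x, fun a => (comp (h a) (i a) (g a)).obj (y a, z a)))
  assoc_map : ∀ {n : ℕ} (i : Fin n → C) (j : C) {k : Fin n → ℕ} (h : ∀ a, Fin (k a) → C)
    {r : ∀ a, Fin (k a) → ℕ} (g : ∀ a b, Fin (r a b) → C)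
    {x x' : Op i j} {y y' : ∀ a, Op (h a) (i a)} {z z' : ∀ a b, Op (g a b) (h a b)}
    (p : x ⟶ x') (q : ∀ a, y a ⟶ y' a) (s : ∀ a b, z a b ⟶ z' a b),
    HEq ((comp (concatTuple h) j (concatTuple g)).map
        (Prod.mkHom ((comp i j h).map (Prod.mkHom p q : (x, y) ⟶ (x', y'))) (concatHom s) :
          ((comp i j h).obj (x, y), concatTuple z) ⟶
            ((comp i j h).obj (x', y'), concatTuple z')))
      ((comp i j (fun a => concatTuple (g a))).map
        (Prod.mkHom p (fun a => (comp (h a) (i a) (g a)).map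
            (Prod.mkHom (q a) (s a) : (y a, z a) ⟶ (y' a, z' a))) :
          (x, fun a => (comp (h a) (i a) (g a)).obj (y a, z a)) ⟶
            (x', fun a => (comp (h a) (i a) (g a)).obj (y' a, z' a))))

namespace CatOperad

attribute [instance] CatOperad.cat

variable {C : Type w}

/-- An algebra (in categories) over the operad `O`: a category `obj i` for every colour `i` with
action functors `Op(i₁,…,iₙ; j) × obj i₁ × ⋯ × obj iₙ ⥤ obj j`, strictly compatible with the
composition and the identities of `O` (on objects and on morphisms). -/
structure Algebra (O : CatOperad.{w, v, v'} C) where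
  /-- the underlying categories -/
  obj : C → Type u
  /-- their category structure -/
  [cat : ∀ i, Category.{u'} (obj i)]
  /-- the action functors -/
  act : ∀ {n : ℕ} (i : Fin n → C) (j : C), O.Op i j × (∀ a, obj (i a)) ⥤ obj j
  act_one_obj : ∀ (j : C) (m : obj j),
    (act (fun _ : Fin 1 => j) j).obj (O.one j, fun _ => m) = m
  act_one_map : ∀ (j : C) {m m' : obj j} (f : m ⟶ m'),
    (act (fun _ : Fin 1 => j) j).map
      (Prod.mkHom (𝟙 (O.one j)) (fun _ => f) :
        ((O.one j, fun _ => m) : O.Op (fun _ : Fin 1 => j) j × (Fin 1 → obj j)) ⟶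
          (O.one j, fun _ => m')) =
      eqToHom (act_one_obj j m) ≫ f ≫ eqToHom (act_one_obj j m').symm
  act_comp_obj : ∀ {n : ℕ} (i : Fin n → C) (j : C) {k : Fin n → ℕ} (h : ∀ a, Fin (k a) → C)
    (x : O.Op i j) (y : ∀ a, O.Op (h a) (i a)) (m : ∀ a b, obj (h a b)),
    (act (concatTuple h) j).obj ((O.comp i j h).obj (x, y), concatTuple m) =
      (act i j).obj (x, fun a => (act (h a) (i a)).obj (y a, m a))
  act_comp_map : ∀ {n : ℕ} (i : Fin n → C) (j : C) {k : Fin n → ℕ} (h : ∀ a, Fin (k a) → C)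
    {x x' : O.Op i j} {y y' : ∀ a, O.Op (h a) (i a)} {m m' : ∀ a b, obj (h a b)}
    (p : x ⟶ x') (q : ∀ a, y a ⟶ y' a) (f : ∀ a b, m a b ⟶ m' a b),
    (act (concatTuple h) j).map
        (Prod.mkHom ((O.comp i j h).map (Prod.mkHom p q : (x, y) ⟶ (x', y'))) (concatHom f) :
          ((O.comp i j h).obj (x, y), concatTuple m) ⟶
            ((O.comp i j h).obj (x', y'), concatTuple m')) =
      eqToHom (act_comp_obj i j h x y m) ≫
        (act i j).map
          (Prod.mkHom p (fun a => (act (h a) (i a)).map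
              (Prod.mkHom (q a) (f a) : (y a, m a) ⟶ (y' a, m' a))) :
            (x, fun a => (act (h a) (i a)).obj (y a, m a)) ⟶
              (x', fun a => (act (h a) (i a)).obj (y' a, m' a))) ≫
        eqToHom (act_comp_obj i j h x' y' m').symm

attribute [instance] Algebra.cat

/-- The insertion functor `X ↦ (m₁, …, m_{k-1}, X, m_{k+1}, …, mₙ)` into a product of categories;
the `k`-th entry of `m` is not used. -/
def insertAt {n : ℕ} {D : Fin n → Type u} [∀ a, Category.{u'} (D a)]
    (m : ∀ a, D a) (k : Fin n) : D k ⥤ (∀ a, D a) :=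
  Functor.pi' fun a =>
    if h : k = a then h ▸ 𝟭 (D k) else (Functor.const (D k)).obj (m a)

namespace Algebra

variable {O : CatOperad.{w, v, v'} C}

/-- The functor `⊗ₓ(m₁, …, m_{k-1}, -, m_{k+1}, …, mₙ)`. -/
def tensorAt (M : Algebra.{w, v, v', u, u'} O) {n : ℕ} {i : Fin n → C} {j : C} (x : O.Op i j)
    (m : ∀ a, M.obj (i a)) (k : Fin n) : M.obj (i k) ⥤ M.obj j :=
  insertAt m k ⋙ Prod.sectR x (∀ a, M.obj (i a)) ⋙ M.act i j

/-- A locally presentable `O`-algebra: all its categories are locally presentable, and each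
operation preserves (small) colimits in each variable. -/
structure IsLocallyPresentable (M : Algebra.{w, v, v', u, u'} O) : Prop where
  locallyPresentable : ∀ i, CategoryTheory.IsLocallyPresentable.{w} (M.obj i)
  preservesColimits : ∀ {n : ℕ} (i : Fin n → C) (j : C) (x : O.Op i j)
    (m : ∀ a, M.obj (i a)) (k : Fin n),
    PreservesColimitsOfSize.{w, w} (M.tensorAt x m k)

end Algebra

/-- A lax morphism of `O`-algebras from `A` to `M`: functors `F i : A i ⥤ M i` and laxity maps
`⊗ₓ(F c₁, …, F cₙ) ⟶ F (⊗ₓ(c₁, …, cₙ))`, natural in `(x, c₁, …, cₙ)` and compatible with the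
identities and the composition of `O`. -/
structure LaxMor {O : CatOperad.{w, v, v'} C} (A : Algebra.{w, v, v', u₁, u₁'} O)
    (M : Algebra.{w, v, v', u, u'} O) where
  /-- the underlying functors -/
  F : ∀ i, A.obj i ⥤ M.obj i
  /-- the laxity maps -/
  lax : ∀ {n : ℕ} (i : Fin n → C) (j : C) (x : O.Op i j) (c : ∀ a, A.obj (i a)),
    (M.act i j).obj (x, fun a => (F (i a)).obj (c a)) ⟶ (F j).obj ((A.act i j).obj (x, c))
  lax_natural : ∀ {n : ℕ} (i : Fin n → C) (j : C) {x x' : O.Op i j} {c c' : ∀ a, A.obj (i a)}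
    (p : x ⟶ x') (f : ∀ a, c a ⟶ c' a),
    (M.act i j).map (Prod.mkHom p (fun a => (F (i a)).map (f a)) :
        (x, fun a => (F (i a)).obj (c a)) ⟶ (x', fun a => (F (i a)).obj (c' a))) ≫
        lax i j x' c' =
      lax i j x c ≫ (F j).map ((A.act i j).map (Prod.mkHom p f : (x, c) ⟶ (x', c')))
  lax_one : ∀ (j : C) (c : A.obj j),
    lax (fun _ : Fin 1 => j) j (O.one j) (fun _ => c) =
      eqToHom ((M.act_one_obj j ((F j).obj c)).trans
        (congrArg (F j).obj (A.act_one_obj j c).symm))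
  lax_comp : ∀ {n : ℕ} (i : Fin n → C) (j : C) {k : Fin n → ℕ} (h : ∀ a, Fin (k a) → C)
    (x : O.Op i j) (y : ∀ a, O.Op (h a) (i a)) (d : ∀ a b, A.obj (h a b)),
    lax (concatTuple h) j ((O.comp i j h).obj (x, y)) (concatTuple d) =
      eqToHom (M.act_comp_obj i j h x y (fun a b => (F (h a b)).obj (d a b))) ≫
        (M.act i j).map
          (Prod.mkHom (𝟙 x) (fun a => lax (h a) (i a) (y a) (d a)) :
            (x, fun a => (M.act (h a) (i a)).obj (y a, fun b => (F (h a b)).obj (d a b))) ⟶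
              (x, fun a => (F (i a)).obj ((A.act (h a) (i a)).obj (y a, d a)))) ≫
        lax i j x (fun a => (A.act (h a) (i a)).obj (y a, d a)) ≫
        eqToHom (congrArg (F j).obj (A.act_comp_obj i j h x y d).symm)

namespace LaxMor

variable {O : CatOperad.{w, v, v'} C} {A : Algebra.{w, v, v', u₁, u₁'} O}
  {M : Algebra.{w, v, v', u, u'} O}

/-- A morphism of lax morphisms: natural transformations commuting with the laxity maps. -/
@[ext]
structure Hom (P Q : LaxMor A M) where
  /-- the underlying natural transformations -/
  σ : ∀ i, P.F i ⟶ Q.F i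
  comm : ∀ {n : ℕ} (i : Fin n → C) (j : C) (x : O.Op i j) (c : ∀ a, A.obj (i a)),
    P.lax i j x c ≫ (σ j).app ((A.act i j).obj (x, c)) =
      (M.act i j).map (Prod.mkHom (𝟙 x) (fun a => (σ (i a)).app (c a)) :
        (x, fun a => (P.F (i a)).obj (c a)) ⟶ (x, fun a => (Q.F (i a)).obj (c a))) ≫
        Q.lax i j x c

/-- The category of lax morphisms from `A` to `M`, with componentwise composition. -/
instance : Category (LaxMor A M) where
  Hom P Q := Hom P Q
  id P :=
    { σ := fun i => 𝟙 (P.F i)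
      comm := fun i j x c => by
        have h := (M.act i j).map_id (x, fun a => (P.F (i a)).obj (c a))
        simp only [NatTrans.id_app, Category.comp_id]
        exact ((congrArg (· ≫ P.lax i j x c) h).trans (Category.id_comp _)).symm }
  comp {P Q R} s t :=
    { σ := fun i => s.σ i ≫ t.σ i
      comm := fun i j x c => by
        have h := (M.act i j).map_comp
          (Prod.mkHom (𝟙 x) (fun a => (s.σ (i a)).app (c a)) :
            (x, fun a => (P.F (i a)).obj (c a)) ⟶ (x, fun a => (Q.F (i a)).obj (c a)))
          (Prod.mkHom (𝟙 x) (fun a => (t.σ (i a)).app (c a)) :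
            (x, fun a => (Q.F (i a)).obj (c a)) ⟶ (x, fun a => (R.F (i a)).obj (c a)))
        have e : (Prod.mkHom (𝟙 x) (fun a => (s.σ (i a) ≫ t.σ (i a)).app (c a)) :
            (x, fun a => (P.F (i a)).obj (c a)) ⟶ (x, fun a => (R.F (i a)).obj (c a))) =
          (Prod.mkHom (𝟙 x) (fun a => (s.σ (i a)).app (c a)) :
            (x, fun a => (P.F (i a)).obj (c a)) ⟶ (x, fun a => (Q.F (i a)).obj (c a))) ≫
          (Prod.mkHom (𝟙 x) (fun a => (t.σ (i a)).app (c a)) :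
            (x, fun a => (Q.F (i a)).obj (c a)) ⟶ (x, fun a => (R.F (i a)).obj (c a))) :=
          Prod.ext (Category.comp_id _).symm rfl
        rw [e, h, Category.assoc, ← t.comm, ← Category.assoc, ← s.comm, NatTrans.comp_app,
          Category.assoc] }
  id_comp s := Hom.ext (funext fun i => Category.id_comp (s.σ i))
  comp_id s := Hom.ext (funext fun i => Category.comp_id (s.σ i))
  assoc s t r := Hom.ext (funext fun i => Category.assoc (s.σ i) (t.σ i) (r.σ i))

variable (A M)

/-- The functor that forgets the laxity maps. -/
def forget : LaxMor A M ⥤ (∀ i, A.obj i ⥤ M.obj i) where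
  obj P := P.F
  map s := Hom.σ s

end LaxMor

end CatOperad

/-! Everything rests on one fact: a functor of `n` variables that preserves colimits in each
variable turns `n` colimits over categories `J₁, …, Jₙ` into a colimit over `J₁ × ⋯ × Jₙ`
(`nonempty_isColimit_pi`). It is used in two ways.

First, if `J` is sifted, the diagonal `J ⥤ Jⁿ` is final, so every `⊗ₓ` preserves `J`-colimits in all
variables jointly. The pointwise colimit of a sifted diagram of lax morphisms therefore carries
unique compatible laxity maps, and `forget` preserves sifted colimits
(`exists_isColimit_of_isSifted`). Filtered colimits and reflexive coequalizers are sifted.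

Second, `forget` has an explicit left adjoint. The free lax morphism on `F` has as value at `c` the
colimit of `⊗ₓ(F d₁, …, F dₙ)` over all operations `x`, objects `d` and morphisms `f : ⊗ₓ(d₁, …, dₙ)
⟶ c`; this is the left Kan extension of the evaluation of formal terms in `M` along their evaluation
in `A`. Since `O` and `A` are small, these colimits exist. By the first fact, `⊗ₓ` of such values is
a colimit over tuples of terms, and substituting the tuples into `x` defines the laxity maps. Their
unit and associativity laws are those of substitution in `O`.

As `forget` is also conservative, the crude monadicity theorem makes it monadic. The monad is
finitary because a left adjoint preserves all colimits and `forget` preserves filtered ones.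
Reflexive coequalizers and the adjoint triangle theorem give all small colimits. The values at the
objects of `A` form a small, jointly faithful and jointly conservative family of finitary right
adjoints into the categories `M.obj i`; their left adjoints carry presentable strong generators to a
presentable strong generator. -/

namespace CategoryTheory

/-! ### Colimits in several variables -/

section ProdCocone

variable {J₁ J₂ X Y E : Type*} [Category* J₁] [Category* J₂] [Category* X] [Category* Y]
  [Category* E]

/-- The product of two cocones. -/
@[simps]
def Limits.Cocone.prod {K₁ : J₁ ⥤ X} {K₂ : J₂ ⥤ Y} (c₁ : Cocone K₁) (c₂ : Cocone K₂) :
    Cocone (K₁.prod K₂) where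
  pt := (c₁.pt, c₂.pt)
  ι :=
    { app := fun j => (Prod.mkHom (c₁.ι.app j.1) (c₂.ι.app j.2) :)
      naturality := fun _ _ f => by
        refine Prod.ext ?_ ?_
        · exact c₁.ι.naturality f.1
        · exact c₂.ι.naturality f.2 }

theorem Limits.IsColimit.exists_desc {K : J₁ ⥤ X} {t : Cocone K} (ht : IsColimit t) {Z : X}
    (f : ∀ j, K.obj j ⟶ Z) (hf : ∀ {a b : J₁} (φ : a ⟶ b), K.map φ ≫ f b = f a) :
    ∃ u : t.pt ⟶ Z, ∀ j, t.ι.app j ≫ u = f j :=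
  ⟨ht.desc ⟨Z, { app := f, naturality := fun _ _ φ => (hf φ).trans (Category.comp_id _).symm }⟩,
    fun j => ht.fac _ j⟩

theorem Limits.IsColimit.nonempty_of_exists_of_ext {K : J₁ ⥤ X} (t : Cocone K)
    (h : ∀ {Z : X} (f : ∀ j, K.obj j ⟶ Z), (∀ {a b : J₁} (φ : a ⟶ b), K.map φ ≫ f b = f a) →
      ∃ u : t.pt ⟶ Z, ∀ j, t.ι.app j ≫ u = f j)
    (h' : ∀ {Z : X} (u v : t.pt ⟶ Z), (∀ j, t.ι.app j ≫ u = t.ι.app j ≫ v) → u = v) :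
    Nonempty (IsColimit t) :=
  ⟨{desc := fun s => (h s.ι.app (fun φ => s.w φ)).choose
    fac := fun s => (h s.ι.app (fun φ => s.w φ)).choose_spec
    uniq := fun s _ hm => h' _ _ fun j =>
      (hm j).trans ((h s.ι.app (fun φ => s.w φ)).choose_spec j).symm }⟩

/-- A functor of two variables that preserves a colimit in each variable preserves the product
of the two colimits. -/
theorem Limits.Cocone.nonempty_isColimit_prod (H : X × Y ⥤ E) {K₁ : J₁ ⥤ X} {K₂ : J₂ ⥤ Y}
    (c₁ : Cocone K₁) (c₂ : Cocone K₂)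
    (h₁ : Nonempty (IsColimit ((Prod.sectL X c₂.pt ⋙ H).mapCocone c₁)))
    (h₂ : ∀ j, Nonempty (IsColimit ((Prod.sectR (K₁.obj j) Y ⋙ H).mapCocone c₂))) :
    Nonempty (IsColimit (H.mapCocone (c₁.prod c₂))) := by
  obtain ⟨h₁⟩ := h₁
  replace h₂ := fun j => (h₂ j).some
  have ext₁ {Z : E} {u v : H.obj (c₁.pt, c₂.pt) ⟶ Z}
      (h : ∀ j, H.map (Prod.mkHom (c₁.ι.app j) (𝟙 c₂.pt) : (K₁.obj j, c₂.pt) ⟶ _) ≫ u =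
        H.map (Prod.mkHom (c₁.ι.app j) (𝟙 c₂.pt) : (K₁.obj j, c₂.pt) ⟶ _) ≫ v) : u = v :=
    h₁.hom_ext h
  have ext₂ (j : J₁) {Z : E} {u v : H.obj (K₁.obj j, c₂.pt) ⟶ Z}
      (h : ∀ j', H.map (Prod.mkHom (𝟙 (K₁.obj j)) (c₂.ι.app j') : (_, K₂.obj j') ⟶ _) ≫ u =
        H.map (Prod.mkHom (𝟙 (K₁.obj j)) (c₂.ι.app j') : (_, K₂.obj j') ⟶ _) ≫ v) : u = v :=
    (h₂ j).hom_ext h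
  have desc₁ {Z : E} (f : ∀ j, H.obj (K₁.obj j, c₂.pt) ⟶ Z)
      (hf : ∀ {a b : J₁} (φ : a ⟶ b), H.map (Prod.mkHom (K₁.map φ) (𝟙 c₂.pt)) ≫ f b = f a) :
      ∃ u : H.obj (c₁.pt, c₂.pt) ⟶ Z,
        ∀ j, H.map (Prod.mkHom (c₁.ι.app j) (𝟙 c₂.pt) : (K₁.obj j, c₂.pt) ⟶ _) ≫ u = f j :=
    h₁.exists_desc f hf
  have desc₂ (j : J₁) {Z : E} (f : ∀ j', H.obj (K₁.obj j, K₂.obj j') ⟶ Z)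
      (hf : ∀ {a b : J₂} (φ : a ⟶ b),
        H.map (Prod.mkHom (𝟙 (K₁.obj j)) (K₂.map φ)) ≫ f b = f a) :
      ∃ u : H.obj (K₁.obj j, c₂.pt) ⟶ Z,
        ∀ j', H.map (Prod.mkHom (𝟙 (K₁.obj j)) (c₂.ι.app j') : (_, K₂.obj j') ⟶ _) ≫ u = f j' :=
    (h₂ j).exists_desc f hf
  have split (j : J₁ × J₂) :
      H.map (Prod.mkHom (c₁.ι.app j.1) (c₂.ι.app j.2) :
        (K₁.obj j.1, K₂.obj j.2) ⟶ (c₁.pt, c₂.pt)) =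
      H.map (Prod.mkHom (𝟙 (K₁.obj j.1)) (c₂.ι.app j.2) : (_, K₂.obj j.2) ⟶ _) ≫
        H.map (Prod.mkHom (c₁.ι.app j.1) (𝟙 c₂.pt) : (K₁.obj j.1, c₂.pt) ⟶ _) := by
    rw [← H.map_comp]
    exact congrArg H.map (Prod.ext (Category.id_comp _).symm (Category.comp_id _).symm)
  have comm {a b : J₁} (φ : a ⟶ b) (j' : J₂) :
      H.map (Prod.mkHom (𝟙 (K₁.obj a)) (c₂.ι.app j') : (_, K₂.obj j') ⟶ _) ≫
        H.map (Prod.mkHom (K₁.map φ) (𝟙 c₂.pt)) =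
      H.map (Prod.mkHom (K₁.map φ) (𝟙 (K₂.obj j'))) ≫
        H.map (Prod.mkHom (𝟙 (K₁.obj b)) (c₂.ι.app j') : (_, K₂.obj j') ⟶ _) := by
    rw [← H.map_comp, ← H.map_comp]
    exact congrArg H.map (Prod.ext ((Category.id_comp _).trans (Category.comp_id _).symm)
      ((Category.comp_id _).trans (Category.id_comp _).symm))
  refine Limits.IsColimit.nonempty_of_exists_of_ext _ (fun {Z} f hf => ?_) (fun {Z} u v huv => ?_)
  · have hf₁ {a b : J₁} (φ : a ⟶ b) (j' : J₂) :
        H.map (Prod.mkHom (K₁.map φ) (𝟙 (K₂.obj j'))) ≫ f (b, j') = f (a, j') := by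
      refine Eq.trans (congrArg (· ≫ f (b, j')) (congrArg H.map ?_))
        (hf (Prod.mkHom φ (𝟙 j') : (a, j') ⟶ (b, j')))
      exact Prod.ext rfl (K₂.map_id j').symm
    have hf₂ (j : J₁) {a b : J₂} (φ : a ⟶ b) :
        H.map (Prod.mkHom (𝟙 (K₁.obj j)) (K₂.map φ)) ≫ f (j, b) = f (j, a) := by
      refine Eq.trans (congrArg (· ≫ f (j, b)) (congrArg H.map ?_))
        (hf (Prod.mkHom (𝟙 j) φ : (j, a) ⟶ (j, b)))
      exact Prod.ext (K₁.map_id j).symm rfl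
    -- Descend along the second variable for each fixed `j`, then along the first. The maps `g j`
    -- are compatible in `j` because this can be tested on the legs of `c₂`.
    choose g hg using fun j => desc₂ j (fun j' => f (j, j')) (hf₂ j)
    obtain ⟨u, hu⟩ := desc₁ g fun {a b} φ => ext₂ a fun j' => by
      rw [← Category.assoc, comm, Category.assoc, hg, hg, hf₁]
    refine ⟨u, fun j => ?_⟩
    refine Eq.trans (congrArg (· ≫ u) (split j)) ?_
    rw [Category.assoc, hu, hg]
  · change H.obj (c₁.pt, c₂.pt) ⟶ Z at u v
    refine ext₁ fun j => ext₂ j fun j' => ?_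
    rw [← Category.assoc, ← Category.assoc, ← split (j, j')]
    exact huv (j, j')

end ProdCocone

section Cons

variable {n : ℕ} (D : Fin (n + 1) → Type*) [∀ a, Category* (D a)]

/-- The functor that adds a first entry to a tuple. -/
@[simps]
def Functor.finCons : D 0 × (∀ a : Fin n, D a.succ) ⥤ ∀ a, D a where
  obj p := Fin.cons p.1 p.2
  map {p q} f := fun a => Fin.cases
    (motive := fun a => (Fin.cons p.1 p.2 : ∀ a, D a) a ⟶ (Fin.cons q.1 q.2 : ∀ a, D a) a)
    f.1 f.2 a
  map_id p := by
    ext a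
    induction a using Fin.cases <;> rfl
  map_comp f g := by
    ext a
    induction a using Fin.cases <;> rfl

instance : (Functor.finCons D).IsEquivalence where
  faithful := ⟨fun {p q} f g h => Prod.ext (congrFun h 0) (funext fun a => congrFun h a.succ)⟩
  full := ⟨fun {p q} f => ⟨Prod.mkHom (f 0) fun a => f a.succ, by
    ext a
    induction a using Fin.cases <;> rfl⟩⟩
  essSurj := ⟨fun X => ⟨(X 0, fun a => X a.succ), ⟨Pi.isoMk fun a =>
    Fin.cases (motive := fun a => ((Functor.finCons D).obj (X 0, fun a => X a.succ)) a ≅ X a)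
      (Iso.refl _) (fun _ => Iso.refl _) a⟩⟩⟩

end Cons

section Separately

variable {n : ℕ} {D : Fin n → Type u} [∀ a, Category.{u'} (D a)] {E : Type u₁} [Category.{u₁'} E]

/-- A functor of `n` variables preserves (small) colimits in each variable separately. -/
def Functor.PreservesColimitsSeparately (G : (∀ a, D a) ⥤ E) : Prop :=
  ∀ (J : Type w) [SmallCategory J] (K : J ⥤ ∀ a, D a) (t : Cocone K) (k : Fin n),
    IsColimit ((Pi.eval D k).mapCocone t) → (∀ a, a ≠ k → ∀ j, IsIso (t.ι.app j a)) →
      Nonempty (IsColimit (G.mapCocone t))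

/-- The product of a family of cocones. -/
@[simps]
def Limits.Cocone.pi {J : Fin n → Type*} [∀ a, Category* (J a)] {K : ∀ a, J a ⥤ D a}
    (c : ∀ a, Cocone (K a)) : Cocone (Functor.pi K) where
  pt := fun a => (c a).pt
  ι :=
    { app := fun j a => (c a).ι.app (j a)
      naturality := fun _ _ f => funext fun a => (c a).ι.naturality (f a) }

theorem insertAt_eval_self (m : ∀ a, D a) (k : Fin n) :
    CatOperad.insertAt m k ⋙ Pi.eval D k = 𝟭 (D k) := by
  rw [CatOperad.insertAt, Functor.pi'_eval, dif_pos rfl]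

theorem insertAt_eval_of_ne (m : ∀ a, D a) {k a : Fin n} (h : k ≠ a) :
    CatOperad.insertAt m k ⋙ Pi.eval D a = (Functor.const (D k)).obj (m a) := by
  rw [CatOperad.insertAt, Functor.pi'_eval, dif_neg h]

/-- A cocone whose legs are invertible in all variables but `k` is isomorphic to the image under
`insertAt` of its `k`-th component. The formulation by such cocones involves no transport along
equalities of indices, so it restricts easily to fewer variables. -/
theorem Functor.preservesColimitsSeparately_of_insertAt (G : (∀ a, D a) ⥤ E)
    (h : ∀ m k, PreservesColimitsOfSize.{w, w} (CatOperad.insertAt m k ⋙ G)) :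
    G.PreservesColimitsSeparately.{w} := by
  intro J _ K t k ht hiso
  let I := CatOperad.insertAt t.pt k
  -- In the entry `k` the insertion functor is the identity. In any other entry it is constant, and
  -- the invertible legs of `t` identify the diagram with that constant.
  have key (a : Fin n) : ∃ (e : I.obj (t.pt k) a ≅ t.pt a)
      (α : K ⋙ Pi.eval D k ⋙ I ⋙ Pi.eval D a ≅ K ⋙ Pi.eval D a),
      ∀ j, α.hom.app j ≫ t.ι.app j a = I.map (t.ι.app j k) a ≫ e.hom := by
    by_cases hk : k = a
    · subst hk
      let β : I ⋙ Pi.eval D k ≅ 𝟭 _ := eqToIso (insertAt_eval_self t.pt k)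
      exact ⟨β.app _, Functor.isoWhiskerLeft (K ⋙ Pi.eval D k) β,
        fun j => (β.hom.naturality (t.ι.app j k)).symm⟩
    · let β : I ⋙ Pi.eval D a ≅ (Functor.const _).obj (t.pt a) :=
        eqToIso (insertAt_eval_of_ne t.pt hk)
      have hi := hiso a (fun h => hk h.symm)
      let γ : K ⋙ Pi.eval D a ≅ (Functor.const J).obj (t.pt a) :=
        NatIso.ofComponents (fun j => @asIso _ _ _ _ (t.ι.app j a) (hi j))
          (fun f => congrFun (t.ι.naturality f) a)
      let δ : K ⋙ Pi.eval D k ⋙ I ⋙ Pi.eval D a ≅ (Functor.const J).obj (t.pt a) :=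
        Functor.isoWhiskerLeft (K ⋙ Pi.eval D k) β
      refine ⟨β.app _, δ ≪≫ γ.symm, fun j => ?_⟩
      have h₁ := β.hom.naturality (t.ι.app j k)
      have h₂ : γ.inv.app j ≫ t.ι.app j a = 𝟙 _ := γ.inv_hom_id_app j
      have h₃ : (δ ≪≫ γ.symm).hom.app j = β.hom.app _ ≫ γ.inv.app j := rfl
      refine ((congrArg (· ≫ t.ι.app j a) h₃).trans (Category.assoc _ _ _)).trans ?_
      exact (congrArg (β.hom.app _ ≫ ·) h₂).trans h₁.symm
  choose e α hα using key
  let α' : (K ⋙ Pi.eval D k) ⋙ I ≅ K := NatIso.pi' fun a => α a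
  have := h t.pt k
  refine ⟨IsColimit.equivOfNatIsoOfIso (Functor.isoWhiskerRight α' G)
    ((I ⋙ G).mapCocone ((Pi.eval D k).mapCocone t)) _ ?_ (isColimitOfPreserves (I ⋙ G) ht)⟩
  refine Cocone.ext (G.mapIso (Pi.isoMk e)) fun j => ?_
  refine Eq.trans (b := (G.map (α'.inv.app j) ≫ G.map (I.map (t.ι.app j k))) ≫
    G.map (Pi.isoMk e).hom) rfl ?_
  rw [← G.map_comp, ← G.map_comp]
  refine congrArg G.map ?_
  rw [Category.assoc]
  have : α'.inv.app j ≫ α'.hom.app j ≫ t.ι.app j = t.ι.app j := by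
    rw [← Category.assoc, Iso.inv_hom_id_app, Category.id_comp]
  refine Eq.trans ?_ this
  refine congrArg (α'.inv.app j ≫ ·) ?_
  funext a
  exact (hα a j).symm

/-- Induction on `n`: split off the first variable, treat the others by the induction hypothesis
with the first one fixed, and join the two by the statement for functors of two variables. -/
theorem Functor.PreservesColimitsSeparately.nonempty_isColimit_pi :
    ∀ {n : ℕ} {D : Fin n → Type u} [∀ a, Category.{u'} (D a)] {G : (∀ a, D a) ⥤ E}
      (_ : G.PreservesColimitsSeparately.{w}) {J : Fin n → Type w} [∀ a, SmallCategory (J a)]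
      {K : ∀ a, J a ⥤ D a} (c : ∀ a, Cocone (K a)) (_ : ∀ a, IsColimit (c a)),
      Nonempty (IsColimit (G.mapCocone (Cocone.pi c)))
  | 0, D, _, G, _, J, _, K, c, _ => by
    let j₀ : ∀ a, J a := fun a => a.elim0
    -- Without variables the diagram has one object, and its leg is the image of the only morphism
    -- there is, hence invertible.
    have e (j : ∀ a, J a) : G.map (fun a => (c a).ι.app (j a)) =
        G.map (eqToHom (funext fun a => a.elim0)) :=
      congrArg G.map (funext fun a => a.elim0)
    have i : IsIso (G.map (fun a => (c a).ι.app (j₀ a))) := by rw [e]; infer_instance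
    refine ⟨⟨fun s => @CategoryTheory.inv _ _ _ _ _ i ≫ s.ι.app j₀, fun s j => ?_,
      fun s m hm => ?_⟩⟩
    · obtain rfl : j = j₀ := funext fun a => a.elim0
      exact @IsIso.hom_inv_id_assoc _ _ _ _ _ i _ _
    · rw [← hm]
      exact (@IsIso.inv_hom_id_assoc _ _ _ _ _ i _ _).symm
  | n + 1, D, _, G, hG, J, _, K, c, hc => by
    let K' := fun a : Fin n => K a.succ
    let c' : ∀ a : Fin n, Cocone (K' a) := fun a => c a.succ
    have h₂ (X : D 0) : Nonempty (IsColimit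
        ((Prod.sectR X (∀ a : Fin n, D a.succ) ⋙ Functor.finCons D ⋙ G).mapCocone
          (Cocone.pi c'))) := by
      refine Functor.PreservesColimitsSeparately.nonempty_isColimit_pi ?_ c' fun a => hc a.succ
      intro I _ L t k ht hiso
      refine hG I (L ⋙ Prod.sectR X (∀ a : Fin n, D a.succ) ⋙ Functor.finCons D)
        ((Prod.sectR X (∀ a : Fin n, D a.succ) ⋙ Functor.finCons D).mapCocone t) k.succ ht ?_
      intro a ha j
      induction a using Fin.cases with
      | zero => exact inferInstanceAs (IsIso (𝟙 X))
      | succ a => exact hiso a (fun h => ha (congrArg Fin.succ h)) j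
    have h₁ : Nonempty (IsColimit
        ((Prod.sectL (D 0) (Cocone.pi c').pt ⋙ Functor.finCons D ⋙ G).mapCocone (c 0))) := by
      refine hG (J 0) (K 0 ⋙ Prod.sectL (D 0) (Cocone.pi c').pt ⋙ Functor.finCons D)
        ((Prod.sectL (D 0) (Cocone.pi c').pt ⋙ Functor.finCons D).mapCocone (c 0)) 0 (hc 0) ?_
      intro a ha j
      induction a using Fin.cases with
      | zero => exact absurd rfl ha
      | succ a => exact inferInstanceAs (IsIso (𝟙 _))
    obtain ⟨h⟩ := Cocone.nonempty_isColimit_prod (Functor.finCons D ⋙ G) (c 0) (Cocone.pi c')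
      h₁ fun j => h₂ _
    -- The colimit just obtained is indexed by pairs; the equivalence `finCons J` is final, so this
    -- suffices.
    refine ⟨Functor.Final.isColimitWhiskerEquiv (Functor.finCons J) _ ?_⟩
    let α : (K 0).prod (Functor.pi K') ⋙ Functor.finCons D ≅ Functor.finCons J ⋙ Functor.pi K :=
      NatIso.ofComponents (fun j => Pi.isoMk fun a => Fin.cases
        (motive := fun a => ((K 0).prod (Functor.pi K') ⋙ Functor.finCons D).obj j a ≅
          (Functor.finCons J ⋙ Functor.pi K).obj j a)
        (Iso.refl _) (fun _ => Iso.refl _) a) (fun {j j'} f => by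
          funext a
          induction a using Fin.cases with
          | zero => exact (Category.comp_id _).trans (Category.id_comp _).symm
          | succ a => exact (Category.comp_id _).trans (Category.id_comp _).symm)
    let β : (Functor.finCons D).obj ((c 0).pt, fun a => (c' a).pt) ≅ fun a => (c a).pt :=
      Pi.isoMk fun a => Fin.cases
        (motive := fun a => (Functor.finCons D).obj ((c 0).pt, fun a => (c' a).pt) a ≅ (c a).pt)
        (Iso.refl _) (fun _ => Iso.refl _) a
    refine IsColimit.equivOfNatIsoOfIso (Functor.isoWhiskerRight α G) _ _ ?_ h
    refine Cocone.ext (G.mapIso β) fun j => ?_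
    let ι := (Functor.finCons D).map
      (Prod.mkHom ((c 0).ι.app j.1) (fun a => (c' a).ι.app (j.2 a)))
    refine Eq.trans (b := G.map ((α.inv.app j ≫ ι) ≫ β.hom)) ?_ (congrArg G.map ?_)
    · exact ((G.map_comp _ _).trans (congrArg (· ≫ G.map β.hom) (G.map_comp _ _))).symm
    funext a
    induction a using Fin.cases with
    | zero => exact (Category.comp_id _).trans (Category.id_comp _)
    | succ a => exact (Category.comp_id _).trans (Category.id_comp _)

end Separately

end CategoryTheory

/-! ### Sifted colimits and reflexive pairs -/

namespace CategoryTheory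

section Sifted

/-- Induction on `n`: for sifted `J`, pairing the identity with a final functor is final, and
`finCons` is an equivalence. For `n = 0` the comma category is `J` itself, which is connected. -/
theorem Functor.final_pi'_id (J : Type*) [Category* J] [IsSifted J] :
    ∀ n : ℕ, (Functor.pi' (fun _ : Fin n => 𝟭 J)).Final
  | 0 => by
    refine ⟨fun d => ?_⟩
    have : (StructuredArrow.proj d (Functor.pi' (fun _ : Fin 0 => 𝟭 J))).IsEquivalence :=
      { faithful := ⟨fun h => StructuredArrow.hom_ext _ _ h⟩
        full := ⟨fun f => ⟨StructuredArrow.homMk f (funext fun a => a.elim0), rfl⟩⟩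
        essSurj := ⟨fun j => ⟨StructuredArrow.mk (Y := j) (fun a => a.elim0), ⟨Iso.refl _⟩⟩⟩ }
    exact isConnected_of_equivalent
      (StructuredArrow.proj d (Functor.pi' (fun _ : Fin 0 => 𝟭 J))).asEquivalence.symm
  | n + 1 => by
    have := Functor.final_pi'_id J n
    have : ((𝟭 J).prod' (Functor.pi' (fun _ : Fin n => 𝟭 J)) ⋙
      Functor.finCons (fun _ : Fin (n + 1) => J)).Final := inferInstance
    refine Functor.final_of_natIso (F := (𝟭 J).prod' (Functor.pi' (fun _ : Fin n => 𝟭 J)) ⋙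
      Functor.finCons (fun _ : Fin (n + 1) => J))
      (NatIso.ofComponents (fun j => Pi.isoMk fun a => Fin.cases
        (motive := fun a => ((𝟭 J).prod' (Functor.pi' (fun _ : Fin n => 𝟭 J)) ⋙
          Functor.finCons (fun _ : Fin (n + 1) => J)).obj j a ≅
            (Functor.pi' (fun _ : Fin (n + 1) => 𝟭 J)).obj j a)
        (Iso.refl _) (fun _ => Iso.refl _) a) (fun {j j'} f => by
          funext a
          induction a using Fin.cases with
          | zero => exact (Category.comp_id _).trans (Category.id_comp _).symm
          | succ a => exact (Category.comp_id _).trans (Category.id_comp _).symm))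

variable {n : ℕ} {D : Fin n → Type u} [∀ a, Category.{u'} (D a)] {E : Type u₁} [Category.{u₁'} E]

/-- A functor of `n` variables that preserves colimits in each variable preserves sifted colimits
in all variables jointly. -/
theorem Functor.PreservesColimitsSeparately.nonempty_isColimit_of_isSifted
    {G : (∀ a, D a) ⥤ E} (hG : G.PreservesColimitsSeparately.{w}) {J : Type w} [SmallCategory J]
    [IsSifted J] {K : J ⥤ ∀ a, D a} (t : Cocone K)
    (ht : ∀ a, IsColimit ((Pi.eval D a).mapCocone t)) :
    Nonempty (IsColimit (G.mapCocone t)) := by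
  obtain ⟨h⟩ := hG.nonempty_isColimit_pi (fun a => (Pi.eval D a).mapCocone t) ht
  have := Functor.final_pi'_id J n
  exact ⟨(Functor.Final.isColimitWhiskerEquiv (Functor.pi' (fun _ : Fin n => 𝟭 J)) _).symm h⟩

open WalkingReflexivePair in
-- The cospans on `a` and `b` must form a connected category. Each maps to a cospan ending in
-- `.zero`, and those are linked by switching legs between `left` and `right`.
instance : IsSifted WalkingReflexivePair where
  nonempty := ⟨.zero⟩
  out := by
    rintro ⟨a, b⟩
    let mk {c : WalkingReflexivePair} (f : a ⟶ c) (g : b ⟶ c) :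
      StructuredArrow (a, b) (Functor.diag WalkingReflexivePair) :=
        StructuredArrow.mk (S := (a, b)) (T := Functor.diag WalkingReflexivePair) (Y := c)
          (Prod.mkHom f g)
    let p (a : WalkingReflexivePair) : a ⟶ .zero :=
      match a with
      | .zero => 𝟙 _
      | .one => Hom.left
    refine IsConnected.of_induct (j₀ := mk (p a) (p b)) fun S h₀ h => ?_
    have step {c d : WalkingReflexivePair} (f : a ⟶ c) (g : b ⟶ c) (u : c ⟶ d) :
        mk f g ∈ S ↔ mk (f ≫ u) (g ≫ u) ∈ S := h (StructuredArrow.homMk u rfl)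
    -- A cospan ending in `.one` links its images under `left` and `right`. A leg that factors
    -- through the reflexion has the same image under both, so the other leg can be switched alone.
    have exchange (f : a ⟶ .one) (g : b ⟶ .one) :
        mk (f ≫ Hom.left) (g ≫ Hom.left) ∈ S ↔ mk (f ≫ Hom.right) (g ≫ Hom.right) ∈ S :=
      (step f g Hom.left).symm.trans (step f g Hom.right)
    have hz (f : WalkingReflexivePair.zero ⟶ .zero) : f = 𝟙 _ := by
      change Hom _ _ at f
      cases f
      rfl
    have ho (f : WalkingReflexivePair.one ⟶ .zero) : f = Hom.left ∨ f = Hom.right := by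
      change Hom _ _ at f
      cases f
      · exact Or.inl rfl
      · exact Or.inr rfl
    have all (f : a ⟶ .zero) (g : b ⟶ .zero) : mk f g ∈ S := by
      cases a with
      | zero =>
        obtain rfl := hz f
        cases b with
        | zero => rw [hz g]; exact h₀
        | one =>
          obtain rfl | rfl := ho g
          · exact h₀
          · exact (exchange Hom.reflexion (𝟙 _)).1 h₀
      | one =>
        cases b with
        | zero =>
          obtain rfl := hz g
          obtain rfl | rfl := ho f
          · exact h₀
          · exact (exchange (𝟙 _) Hom.reflexion).1 h₀
        | one =>
          have h₁ : mk Hom.left Hom.right ∈ S := (exchange Hom.leftCompReflexion (𝟙 _)).1 h₀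
          obtain rfl | rfl := ho f <;> obtain rfl | rfl := ho g
          · exact h₀
          · exact h₁
          · exact (exchange (𝟙 _) Hom.leftCompReflexion).1 h₀
          · exact (exchange (𝟙 _) Hom.rightCompReflexion).1 h₁
    rintro ⟨⟨⟨⟩⟩, c, f⟩
    cases c with
    | zero => exact all f.1 f.2
    | one => exact (step f.1 f.2 Hom.left).2 (all _ _)

end Sifted

end CategoryTheory

/-! ### Tensor notation for operads and algebras -/

namespace CatOperad

variable {C : Type w} {O : CatOperad.{w, v, v'} C}

/-- The value of the substitution functor on objects. -/
def subst (O : CatOperad.{w, v, v'} C) {n : ℕ} {i : Fin n → C} {j : C} {k : Fin n → ℕ}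
    {h : ∀ a, Fin (k a) → C} (x : O.Op i j) (y : ∀ a, O.Op (h a) (i a)) :
    O.Op (concatTuple h) j :=
  (O.comp i j h).obj (x, y)

/-- The value of the substitution functor on morphisms. -/
def substHom (O : CatOperad.{w, v, v'} C) {n : ℕ} {i : Fin n → C} {j : C} {k : Fin n → ℕ}
    {h : ∀ a, Fin (k a) → C} {x x' : O.Op i j} {y y' : ∀ a, O.Op (h a) (i a)}
    (p : x ⟶ x') (q : ∀ a, y a ⟶ y' a) : O.subst x y ⟶ O.subst x' y' :=
  (O.comp i j h).map (Prod.mkHom p q : (x, y) ⟶ (x', y'))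

namespace Algebra

variable (M : Algebra.{w, v, v', u, u'} O)

/-- The object `⊗ₓ(m₁, …, mₙ)`. -/
def tensor {n : ℕ} {i : Fin n → C} {j : C} (x : O.Op i j) (m : ∀ a, M.obj (i a)) : M.obj j :=
  (M.act i j).obj (x, m)

/-- The functoriality of `⊗ₓ(m₁, …, mₙ)`. -/
def tensorHom {n : ℕ} {i : Fin n → C} {j : C} {x x' : O.Op i j} {m m' : ∀ a, M.obj (i a)}
    (p : x ⟶ x') (f : ∀ a, m a ⟶ m' a) : M.tensor x m ⟶ M.tensor x' m' :=
  (M.act i j).map (Prod.mkHom p f : (x, m) ⟶ (x', m'))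

theorem tensorHom_id {n : ℕ} {i : Fin n → C} {j : C} (x : O.Op i j) (m : ∀ a, M.obj (i a)) :
    M.tensorHom (𝟙 x) (fun a => 𝟙 (m a)) = 𝟙 (M.tensor x m) :=
  (M.act i j).map_id (x, m)

theorem tensorHom_comp {n : ℕ} {i : Fin n → C} {j : C} {x x' x'' : O.Op i j}
    {m m' m'' : ∀ a, M.obj (i a)} (p : x ⟶ x') (p' : x' ⟶ x'') (f : ∀ a, m a ⟶ m' a)
    (f' : ∀ a, m' a ⟶ m'' a) :
    M.tensorHom p f ≫ M.tensorHom p' f' = M.tensorHom (p ≫ p') (fun a => f a ≫ f' a) :=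
  ((M.act i j).map_comp (Prod.mkHom p f : (x, m) ⟶ (x', m'))
    (Prod.mkHom p' f' : (x', m') ⟶ (x'', m''))).symm

theorem tensorHom_comp_assoc {n : ℕ} {i : Fin n → C} {j : C} {x x' x'' : O.Op i j}
    {m m' m'' : ∀ a, M.obj (i a)} (p : x ⟶ x') (p' : x' ⟶ x'') (f : ∀ a, m a ⟶ m' a)
    (f' : ∀ a, m' a ⟶ m'' a) {Z : M.obj j} (g : M.tensor x'' m'' ⟶ Z) :
    M.tensorHom p f ≫ M.tensorHom p' f' ≫ g =
      M.tensorHom (p ≫ p') (fun a => f a ≫ f' a) ≫ g := by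
  rw [← Category.assoc, tensorHom_comp]

theorem tensor_one {j : C} (m : M.obj j) :
    M.tensor (i := fun _ : Fin 1 => j) (O.one j) (fun _ => m) = m :=
  M.act_one_obj j m

theorem tensorHom_one {j : C} {m m' : M.obj j} (f : m ⟶ m') :
    M.tensorHom (i := fun _ : Fin 1 => j) (𝟙 (O.one j)) (fun _ => f) =
      eqToHom (M.tensor_one m) ≫ f ≫ eqToHom (M.tensor_one m').symm :=
  M.act_one_map j f

section

variable {n : ℕ} {i : Fin n → C} {j : C} {k : Fin n → ℕ} {h : ∀ a, Fin (k a) → C}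

theorem tensor_subst (x : O.Op i j) (y : ∀ a, O.Op (h a) (i a)) (m : ∀ a b, M.obj (h a b)) :
    M.tensor (O.subst x y) (concatTuple m) = M.tensor x (fun a => M.tensor (y a) (m a)) :=
  M.act_comp_obj i j h x y m

theorem tensorHom_subst {x x' : O.Op i j} {y y' : ∀ a, O.Op (h a) (i a)}
    {m m' : ∀ a b, M.obj (h a b)} (p : x ⟶ x') (q : ∀ a, y a ⟶ y' a)
    (f : ∀ a b, m a b ⟶ m' a b) :
    M.tensorHom (O.substHom p q) (concatHom f) =
      eqToHom (M.tensor_subst x y m) ≫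
        M.tensorHom p (fun a => M.tensorHom (q a) (f a)) ≫
          eqToHom (M.tensor_subst x' y' m').symm :=
  M.act_comp_map i j h p q f

theorem substHom_id (x : O.Op i j) (y : ∀ a, O.Op (h a) (i a)) :
    O.substHom (𝟙 x) (fun a => 𝟙 (y a)) = 𝟙 (O.subst x y) :=
  (O.comp i j h).map_id (x, y)

theorem tensorHom_subst_id (x : O.Op i j) (y : ∀ a, O.Op (h a) (i a))
    {m m' : ∀ a b, M.obj (h a b)} (f : ∀ a b, m a b ⟶ m' a b) :
    M.tensorHom (𝟙 (O.subst x y)) (concatHom f) ≫ eqToHom (M.tensor_subst x y m') =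
      eqToHom (M.tensor_subst x y m) ≫
        M.tensorHom (𝟙 x) (fun a => M.tensorHom (𝟙 (y a)) (f a)) := by
  rw [← substHom_id, tensorHom_subst]
  simp only [Category.assoc, eqToHom_trans, eqToHom_refl, Category.comp_id]

end

/-- The functor `⊗ₓ` of `n` variables. -/
def tensorFunctor {n : ℕ} {i : Fin n → C} {j : C} (x : O.Op i j) :
    (∀ a, M.obj (i a)) ⥤ M.obj j :=
  Prod.sectR x (∀ a, M.obj (i a)) ⋙ M.act i j

variable {M} in
theorem IsLocallyPresentable.preservesColimitsSeparately (hM : M.IsLocallyPresentable)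
    {n : ℕ} {i : Fin n → C} {j : C} (x : O.Op i j) :
    (M.tensorFunctor x).PreservesColimitsSeparately.{w} :=
  Functor.preservesColimitsSeparately_of_insertAt _ fun m k => hM.preservesColimits i j x m k

end Algebra

/-! ### Sifted colimits of lax morphisms -/

namespace LaxMor

variable {A : Algebra.{w, v, v', u₁, u₁'} O} {M : Algebra.{w, v, v', u, u'} O}

/-- The laxity maps of a lax morphism. -/
def μ (P : LaxMor A M) {n : ℕ} {i : Fin n → C} {j : C} (x : O.Op i j) (c : ∀ a, A.obj (i a)) :
    M.tensor x (fun a => (P.F (i a)).obj (c a)) ⟶ (P.F j).obj (A.tensor x c) :=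
  P.lax i j x c

section

variable (P : LaxMor A M)

theorem μ_natural {n : ℕ} {i : Fin n → C} {j : C} {x x' : O.Op i j} {c c' : ∀ a, A.obj (i a)}
    (p : x ⟶ x') (f : ∀ a, c a ⟶ c' a) :
    M.tensorHom p (fun a => (P.F (i a)).map (f a)) ≫ P.μ x' c' =
      P.μ x c ≫ (P.F j).map (A.tensorHom p f) :=
  P.lax_natural i j p f

theorem μ_one {j : C} (c : A.obj j) :
    P.μ (i := fun _ : Fin 1 => j) (O.one j) (fun _ => c) =
      eqToHom ((M.tensor_one ((P.F j).obj c)).trans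
        (congrArg (P.F j).obj (A.tensor_one c).symm)) :=
  P.lax_one j c

theorem μ_subst {n : ℕ} {i : Fin n → C} {j : C} {k : Fin n → ℕ} {h : ∀ a, Fin (k a) → C}
    (x : O.Op i j) (y : ∀ a, O.Op (h a) (i a)) (d : ∀ a b, A.obj (h a b)) :
    P.μ (O.subst x y) (concatTuple d) =
      eqToHom (M.tensor_subst x y (fun a b => (P.F (h a b)).obj (d a b))) ≫
        M.tensorHom (𝟙 x) (fun a => P.μ (y a) (d a)) ≫
          P.μ x (fun a => A.tensor (y a) (d a)) ≫
            eqToHom (congrArg (P.F j).obj (A.tensor_subst x y d).symm) :=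
  P.lax_comp i j h x y d

/-- A constructor for lax morphisms. -/
def ofμ (F : ∀ i, A.obj i ⥤ M.obj i)
    (μ : ∀ {n : ℕ} {i : Fin n → C} {j : C} (x : O.Op i j) (c : ∀ a, A.obj (i a)),
      M.tensor x (fun a => (F (i a)).obj (c a)) ⟶ (F j).obj (A.tensor x c))
    (μ_natural : ∀ {n : ℕ} {i : Fin n → C} {j : C} {x x' : O.Op i j} {c c' : ∀ a, A.obj (i a)}
      (p : x ⟶ x') (f : ∀ a, c a ⟶ c' a),
      M.tensorHom p (fun a => (F (i a)).map (f a)) ≫ μ x' c' =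
        μ x c ≫ (F j).map (A.tensorHom p f))
    (μ_one : ∀ {j : C} (c : A.obj j),
      μ (i := fun _ : Fin 1 => j) (O.one j) (fun _ => c) =
        eqToHom ((M.tensor_one ((F j).obj c)).trans
          (congrArg (F j).obj (A.tensor_one c).symm)))
    (μ_subst : ∀ {n : ℕ} {i : Fin n → C} {j : C} {k : Fin n → ℕ} {h : ∀ a, Fin (k a) → C}
      (x : O.Op i j) (y : ∀ a, O.Op (h a) (i a)) (d : ∀ a b, A.obj (h a b)),
      μ (O.subst x y) (concatTuple d) =
        eqToHom (M.tensor_subst x y (fun a b => (F (h a b)).obj (d a b))) ≫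
          M.tensorHom (𝟙 x) (fun a => μ (y a) (d a)) ≫
            μ x (fun a => A.tensor (y a) (d a)) ≫
              eqToHom (congrArg (F j).obj (A.tensor_subst x y d).symm)) :
    LaxMor A M where
  F := F
  lax _ _ x c := μ x c
  lax_natural _ _ _ _ _ _ p f := μ_natural p f
  lax_one _ c := μ_one c
  lax_comp _ _ _ _ x y d := μ_subst x y d

end

variable {P Q : LaxMor A M}

theorem Hom.μ_comm (s : P ⟶ Q) {n : ℕ} {i : Fin n → C} {j : C} (x : O.Op i j)
    (c : ∀ a, A.obj (i a)) :
    P.μ x c ≫ (Hom.σ s j).app (A.tensor x c) =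
      M.tensorHom (𝟙 x) (fun a => (Hom.σ s (i a)).app (c a)) ≫ Q.μ x c :=
  Hom.comm s i j x c

/-- A constructor for morphisms of lax morphisms. -/
def homMk (σ : ∀ i, P.F i ⟶ Q.F i)
    (h : ∀ {n : ℕ} {i : Fin n → C} {j : C} (x : O.Op i j) (c : ∀ a, A.obj (i a)),
      P.μ x c ≫ (σ j).app (A.tensor x c) =
        M.tensorHom (𝟙 x) (fun a => (σ (i a)).app (c a)) ≫ Q.μ x c) : P ⟶ Q :=
  ({ σ := σ, comm := fun _ _ x c => h x c } : Hom P Q)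

@[ext]
theorem hom_ext {s t : P ⟶ Q} (h : ∀ i c, (Hom.σ s i).app c = (Hom.σ t i).app c) : s = t :=
  Hom.ext (funext fun i => NatTrans.ext (funext fun c => h i c))

/-- The inverse of an invertible family commutes with the laxity maps automatically: compose the
square of `s` with the inverses on both sides. -/
instance : (forget A M).ReflectsIsomorphisms where
  reflects {P Q} s hs := by
    obtain ⟨τ, h₁, h₂⟩ : ∃ τ : ∀ i, Q.F i ⟶ P.F i,
        (∀ i, Hom.σ s i ≫ τ i = 𝟙 (P.F i)) ∧ ∀ i, τ i ≫ Hom.σ s i = 𝟙 (Q.F i) :=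
      ⟨inv ((forget A M).map s), fun i => congrFun (IsIso.hom_inv_id ((forget A M).map s)) i,
        fun i => congrFun (IsIso.inv_hom_id ((forget A M).map s)) i⟩
    refine ⟨homMk τ ?_, Hom.ext (funext h₁), Hom.ext (funext h₂)⟩
    intro n i j x c
    have h₁' (i) (c) : (Hom.σ s i).app c ≫ (τ i).app c = 𝟙 _ := NatTrans.congr_app (h₁ i) c
    have h₂' (i) (c) : (τ i).app c ≫ (Hom.σ s i).app c = 𝟙 _ := NatTrans.congr_app (h₂ i) c
    have h₃ := Hom.μ_comm s x c
    have h₄ : M.tensorHom (𝟙 x) (fun a => (τ (i a)).app (c a)) ≫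
        M.tensorHom (𝟙 x) (fun a => (Hom.σ s (i a)).app (c a)) = 𝟙 _ := by
      rw [M.tensorHom_comp, Category.comp_id]
      simp only [h₂', M.tensorHom_id]
    calc Q.μ x c ≫ (τ j).app (A.tensor x c) =
        (M.tensorHom (𝟙 x) (fun a => (τ (i a)).app (c a)) ≫
          M.tensorHom (𝟙 x) (fun a => (Hom.σ s (i a)).app (c a))) ≫
            Q.μ x c ≫ (τ j).app (A.tensor x c) := by rw [h₄, Category.id_comp]
      _ = _ := by
        rw [Category.assoc, ← Category.assoc _ (Q.μ x c), ← h₃, Category.assoc, h₁',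
          Category.comp_id]

section Sifted

variable (A M) in
/-- The value of the underlying functors of lax morphisms at an object. -/
def value (i : C) (c : A.obj i) : LaxMor A M ⥤ M.obj i :=
  forget A M ⋙ Pi.eval _ i ⋙ (evaluation _ _).obj c

variable {J : Type w} [SmallCategory J]

/-- Colimits in the product of the functor categories are computed pointwise. -/
theorem nonempty_isColimit_forget {D : J ⥤ LaxMor A M} (t : Cocone D)
    (ht : ∀ i c, Nonempty (IsColimit ((value A M i c).mapCocone t))) :
    Nonempty (IsColimit ((forget A M).mapCocone t)) := by
  have h (i : C) : IsColimit ((forget A M ⋙ Pi.eval _ i).mapCocone t) :=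
    evaluationJointlyReflectsColimits _ fun c => (ht i c).some
  refine Limits.IsColimit.nonempty_of_exists_of_ext _ (fun {Z} f hf => ?_) (fun {Z} u v huv => ?_)
  · choose u hu using fun i => (h i).exists_desc (fun s => f s i) (fun φ => congrFun (hf φ) i)
    exact ⟨u, fun s => funext fun i => hu i s⟩
  · exact funext fun i => (h i).hom_ext fun s => congrFun (huv s) i

/-- Take the pointwise colimit `F`. As `⊗ₓ` preserves sifted colimits jointly, the objects `⊗ₓ(F c₁,
…, F cₙ)` are again colimits, so laxity maps on `F` are induced and their axioms can be checked on
legs. -/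
theorem exists_isColimit_of_isSifted [IsSifted J] (hM : M.IsLocallyPresentable)
    (D : J ⥤ LaxMor A M) :
    ∃ t : Cocone D, Nonempty (IsColimit t) ∧
      ∀ i c, Nonempty (IsColimit ((value A M i c).mapCocone t)) := by
  have := hM.locallyPresentable
  have hcol (i : C) : HasColimitsOfShape J (M.obj i) := by
    obtain ⟨κ, _, _⟩ := IsLocallyPresentable.exists_cardinal (M.obj i)
    infer_instance
  -- This makes the chosen colimits opaque. Only the legs and two universal properties remain: that
  -- of `⊗ₓ(F c₁, …, F cₙ)` and that of each functor `F i`.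
  obtain ⟨F, ι, hι, ext, desc, ext', desc', hpt⟩ : ∃ (F : ∀ i, A.obj i ⥤ M.obj i)
      (ι : ∀ s i, (D.obj s).F i ⟶ F i),
      (∀ {s s' : J} (f : s ⟶ s') (i) (c : A.obj i),
        (Hom.σ (D.map f) i).app c ≫ (ι s' i).app c = (ι s i).app c) ∧
      (∀ {n : ℕ} {i : Fin n → C} {j : C} (x : O.Op i j) (c : ∀ a, A.obj (i a)) {Z : M.obj j}
        {u v : M.tensor x (fun a => (F (i a)).obj (c a)) ⟶ Z},
          (∀ s, M.tensorHom (𝟙 x) (fun a => (ι s (i a)).app (c a)) ≫ u =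
            M.tensorHom (𝟙 x) (fun a => (ι s (i a)).app (c a)) ≫ v) → u = v) ∧
      (∀ {n : ℕ} {i : Fin n → C} {j : C} (x : O.Op i j) (c : ∀ a, A.obj (i a)) {Z : M.obj j}
        (f : ∀ s, M.tensor x (fun a => ((D.obj s).F (i a)).obj (c a)) ⟶ Z),
        (∀ {s s' : J} (φ : s ⟶ s'),
          M.tensorHom (𝟙 x) (fun a => (Hom.σ (D.map φ) (i a)).app (c a)) ≫ f s' = f s) →
        ∃ u : M.tensor x (fun a => (F (i a)).obj (c a)) ⟶ Z,
          ∀ s, M.tensorHom (𝟙 x) (fun a => (ι s (i a)).app (c a)) ≫ u = f s) ∧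
      (∀ i {G : A.obj i ⥤ M.obj i} {u v : F i ⟶ G}, (∀ s, ι s i ≫ u = ι s i ≫ v) → u = v) ∧
      (∀ i {G : A.obj i ⥤ M.obj i} (f : ∀ s, (D.obj s).F i ⟶ G),
        (∀ {s s' : J} (φ : s ⟶ s'), Hom.σ (D.map φ) i ≫ f s' = f s) →
        ∃ u : F i ⟶ G, ∀ s, ι s i ≫ u = f s) ∧
      (∀ (t : Cocone D) (e : t.pt.F = F), (∀ s i, Hom.σ (t.ι.app s) i =
        ι s i ≫ eqToHom (congrFun e i).symm) →
        ∀ i c, Nonempty (IsColimit ((value A M i c).mapCocone t))) := by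
    let T (i : C) := colimit.cocone (D ⋙ forget A M ⋙ Pi.eval _ i)
    have hT (i : C) : IsColimit (T i) := colimit.isColimit _
    have hT' (i : C) (c : A.obj i) : IsColimit (((evaluation _ _).obj c).mapCocone (T i)) :=
      isColimitOfPreserves _ (hT i)
    have hx {n : ℕ} {i : Fin n → C} {j : C} (x : O.Op i j) (c : ∀ a, A.obj (i a)) :
        Nonempty (IsColimit ((M.tensorFunctor x).mapCocone
          (({ pt := fun a => ((T (i a)).pt).obj (c a)
              ι := { app := fun s a => ((T (i a)).ι.app s).app (c a)
                     naturality := fun s s' f => funext fun a =>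
                      NatTrans.congr_app ((T (i a)).ι.naturality f) (c a) } } :
            Cocone (Functor.pi' fun a => D ⋙ value A M (i a) (c a)))))) :=
      (hM.preservesColimitsSeparately x).nonempty_isColimit_of_isSifted _
        fun a => hT' (i a) (c a)
    refine ⟨fun i => (T i).pt, fun s i => (T i).ι.app s, fun {s s'} f i c => ?_,
      fun {n i j} x c {Z u v} h => (hx x c).some.hom_ext h,
      fun {n i j} x c {Z} f hf => (hx x c).some.exists_desc f hf,
      fun i {G u v} h => (hT i).hom_ext h,
      fun i {G} f hf => (hT i).exists_desc f hf, ?_⟩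
    · exact NatTrans.congr_app ((T i).w f) c
    · rintro t e ht i c
      refine ⟨(IsColimit.equivOfNatIsoOfIso (Iso.refl _) _ _ ?_) (hT' i c)⟩
      refine Cocone.ext (((evaluation _ _).obj c).mapIso (eqToIso (congrFun e i).symm))
        fun s => ?_
      have h := NatTrans.congr_app (ht s i) c
      refine Eq.trans ?_ h.symm
      exact congrArg (· ≫ _) (Category.id_comp _)
  choose μ hμ using fun {n : ℕ} {i : Fin n → C} {j : C} (x : O.Op i j) (c : ∀ a, A.obj (i a)) =>
    desc x c (fun s => (D.obj s).μ x c ≫ (ι s j).app (A.tensor x c)) (fun {s s'} φ => by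
      rw [← Category.assoc, ← Hom.μ_comm, Category.assoc, hι])
  let P : LaxMor A M := ofμ F μ
    (fun {n i j x x' c c'} p f => ext x c fun s => by
      have h₁ : M.tensorHom (𝟙 x) (fun a => (ι s (i a)).app (c a)) ≫
          M.tensorHom p (fun a => (F (i a)).map (f a)) =
          M.tensorHom p (fun a => ((D.obj s).F (i a)).map (f a)) ≫
            M.tensorHom (𝟙 x') (fun a => (ι s (i a)).app (c' a)) := by
        rw [M.tensorHom_comp, M.tensorHom_comp, Category.id_comp, Category.comp_id]
        simp only [NatTrans.naturality]
      rw [← Category.assoc, h₁, Category.assoc, hμ x' c' s, ← Category.assoc, μ_natural,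
        ← Category.assoc, hμ x c s, Category.assoc, Category.assoc, NatTrans.naturality])
    (fun {j} c => ext _ _ fun s => by
      rw [hμ, μ_one, M.tensorHom_one]
      simp only [Category.assoc, eqToHom_trans]
      rw [eqToHom_naturality (fun c => (ι s j).app c) (A.tensor_one c).symm,
        eqToHom_trans_assoc])
    (fun {n i j k h} x y d => ext _ _ fun s => by
      have h₁ := M.tensorHom_subst_id x y (fun a b => (ι s (h a b)).app (d a b))
      have h₂ : M.tensorHom (𝟙 x) (fun a => M.tensorHom (𝟙 (y a))
            (fun b => (ι s (h a b)).app (d a b))) ≫ M.tensorHom (𝟙 x) (fun a => μ (y a) (d a)) =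
          M.tensorHom (𝟙 x) (fun a => (D.obj s).μ (y a) (d a)) ≫
            M.tensorHom (𝟙 x) (fun a => (ι s (i a)).app (A.tensor (y a) (d a))) := by
        rw [M.tensorHom_comp, M.tensorHom_comp]
        simp only [hμ]
      rw [hμ, μ_subst]
      refine Eq.trans ?_ ((Category.assoc _ _ _).symm.trans
        ((congrArg (· ≫ _) h₁).trans (Category.assoc _ _ _))).symm
      rw [reassoc_of% h₂, reassoc_of% (hμ x (fun a => A.tensor (y a) (d a)) s),
        eqToHom_naturality (fun c => (ι s j).app c) (A.tensor_subst x y d).symm]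
      simp only [Category.assoc])
  let t : Cocone D :=
    { pt := P
      ι :=
        { app := fun s => homMk (ι s) fun x c => (hμ x c s).symm
          naturality := fun s s' f => hom_ext fun i c =>
            (hι f i c).trans (Category.comp_id _).symm } }
  refine ⟨t, Limits.IsColimit.nonempty_of_exists_of_ext _ (fun {Z} f hf => ?_)
    (fun {Z} u v huv => ?_), hpt t rfl fun s i => (Category.comp_id _).symm⟩
  · choose u hu using fun i => desc' i (fun s => Hom.σ (f s) i)
      (fun φ => congrArg (fun g => Hom.σ g i) (hf φ))
    refine ⟨homMk u fun x c => ext x c fun s => ?_, fun s => Hom.ext (funext fun i => hu i s)⟩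
    have hu' (i) (c) : (ι s i).app c ≫ (u i).app c = (Hom.σ (f s) i).app c :=
      NatTrans.congr_app (hu i s) c
    have key : (M.tensorHom (𝟙 x) (fun a => (ι s (_ : C)).app (c a)) ≫ μ x c) ≫
        (u _).app (A.tensor x c) = M.tensorHom (𝟙 x) (fun a => (ι s _).app (c a)) ≫
          M.tensorHom (𝟙 x) (fun a => (u _).app (c a)) ≫ Z.μ x c := by
      rw [hμ x c s, Category.assoc, hu', Hom.μ_comm, M.tensorHom_comp_assoc, Category.comp_id]
      simp only [hu']
    exact (Category.assoc _ _ _).symm.trans key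
  · exact Hom.ext (funext fun i => ext' i fun s => congrArg (fun g => Hom.σ g i) (huv s))

end Sifted

end LaxMor

end CatOperad

/-! ### Concatenation of finite sequences -/

section Concat

variable {n : ℕ} {k : Fin n → ℕ}

theorem finSigmaFinEquiv_lt_of_lex {p q : (a : Fin n) × Fin (k a)}
    (h : p.1 < q.1 ∨ (p.1 = q.1 ∧ p.2.val < q.2.val)) :
    finSigmaFinEquiv p < finSigmaFinEquiv q := by
  -- Extended by zero, the offsets in `finSigmaFinEquiv` become sums over `Finset.range`, which are
  -- monotone in the bound.
  let K : ℕ → ℕ := fun t => if h : t < n then k ⟨t, h⟩ else 0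
  have hK (a : Fin n) : ∑ i : Fin a, k (Fin.castLE a.2.le i) = ∑ t ∈ Finset.range a, K t := by
    rw [Finset.sum_range]
    refine Finset.sum_congr rfl fun i _ => ?_
    have : i.val < n := i.2.trans a.2
    simp only [K, this, dif_pos]
    rfl
  rw [Fin.lt_def, finSigmaFinEquiv_apply, finSigmaFinEquiv_apply, hK, hK]
  obtain h | ⟨h, h'⟩ := h
  · have h₁ : ∑ t ∈ Finset.range (p.1 + 1), K t ≤ ∑ t ∈ Finset.range q.1, K t :=
      Finset.sum_le_sum_of_subset (Finset.range_subset_range.2 h)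
    rw [Finset.sum_range_succ] at h₁
    have h₂ : K p.1 = k p.1 := dif_pos p.1.2
    have := p.2.2
    omega
  · have e : p.1.val = q.1.val := congrArg Fin.val h
    simp only [e]
    omega

theorem lex_of_finSigmaFinEquiv_lt {p q : (a : Fin n) × Fin (k a)}
    (h : finSigmaFinEquiv p < finSigmaFinEquiv q) :
    p.1 < q.1 ∨ (p.1 = q.1 ∧ p.2.val < q.2.val) := by
  obtain ⟨a, b⟩ := p
  obtain ⟨a', b'⟩ := q
  by_contra hn
  push Not at hn
  obtain h₁ | rfl := hn.1.lt_or_eq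
  · exact lt_asymm h (finSigmaFinEquiv_lt_of_lex (Or.inl h₁))
  · obtain h₂ | h₂ := (hn.2 rfl).lt_or_eq
    · exact lt_asymm h (finSigmaFinEquiv_lt_of_lex (Or.inr ⟨rfl, h₂⟩))
    · obtain rfl : b' = b := Fin.ext h₂
      exact lt_irrefl _ h

theorem sum_concatTuple (r : ∀ a, Fin (k a) → ℕ) :
    ∑ c, concatTuple r c = ∑ a, ∑ b, r a b := by
  rw [← Fintype.sum_sigma', ← Equiv.sum_comp finSigmaFinEquiv.symm]

theorem finSigmaFinEquiv_mk_lt {r : ∀ a, Fin (k a) → ℕ} (p q : (a : Fin n) × Fin (k a))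
    (p' : Fin (r p.1 p.2)) (q' : Fin (r q.1 q.2)) (h : finSigmaFinEquiv p < finSigmaFinEquiv q) :
    finSigmaFinEquiv (n := fun a => ∑ b, r a b) ⟨p.1, finSigmaFinEquiv ⟨p.2, p'⟩⟩ <
      finSigmaFinEquiv (n := fun a => ∑ b, r a b) ⟨q.1, finSigmaFinEquiv ⟨q.2, q'⟩⟩ := by
  obtain ⟨a, b⟩ := p
  obtain ⟨a', b'⟩ := q
  refine finSigmaFinEquiv_lt_of_lex ?_
  obtain h | ⟨rfl, h⟩ := lex_of_finSigmaFinEquiv_lt h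
  · exact Or.inl h
  · exact Or.inr ⟨rfl, finSigmaFinEquiv_lt_of_lex (Or.inl h)⟩

/-- Flattening a twofold sequence of finite tuples does not depend on the bracketing. -/
theorem finSigmaFinEquiv_symm_assoc (r : ∀ a, Fin (k a) → ℕ) (c : Fin (∑ c, concatTuple r c)) :
    (⟨(finSigmaFinEquiv.symm (finSigmaFinEquiv.symm c).1).1,
      (finSigmaFinEquiv.symm (finSigmaFinEquiv.symm c).1).2, (finSigmaFinEquiv.symm c).2⟩ :
        (a : Fin n) × (b : Fin (k a)) × Fin (r a b)) =
    ⟨(finSigmaFinEquiv.symm (Fin.cast (sum_concatTuple r) c)).1,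
      finSigmaFinEquiv.symm (finSigmaFinEquiv.symm (Fin.cast (sum_concatTuple r) c)).2⟩ := by
  let φ : Fin (∑ c, concatTuple r c) → Fin (∑ a, ∑ b, r a b) := fun c =>
    finSigmaFinEquiv (n := fun a => ∑ b, r a b)
      ⟨(finSigmaFinEquiv.symm (finSigmaFinEquiv.symm c).1).1,
        finSigmaFinEquiv ⟨(finSigmaFinEquiv.symm (finSigmaFinEquiv.symm c).1).2,
          (finSigmaFinEquiv.symm c).2⟩⟩
  -- Both `φ` and the cast are strictly increasing and surjective. Strictly increasing maps with the
  -- same range, out of a finite linear order, are equal, so no offsets need to be computed.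
  have hφ : StrictMono φ := by
    intro c d h
    have h₁ : finSigmaFinEquiv (finSigmaFinEquiv.symm c) <
      finSigmaFinEquiv (finSigmaFinEquiv.symm d) := by simpa using h
    have h₁ := lex_of_finSigmaFinEquiv_lt h₁
    simp only [φ]
    generalize finSigmaFinEquiv.symm c = p at h₁ ⊢
    generalize finSigmaFinEquiv.symm d = q at h₁ ⊢
    obtain ⟨p₁, p₂⟩ := p
    obtain ⟨q₁, q₂⟩ := q
    refine finSigmaFinEquiv_lt_of_lex ?_
    simp only [] at h₁ ⊢
    obtain h₁ | ⟨rfl, h₁⟩ := h₁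
    · exact lex_of_finSigmaFinEquiv_lt
        (finSigmaFinEquiv_mk_lt (r := r) (finSigmaFinEquiv.symm p₁) (finSigmaFinEquiv.symm q₁)
          p₂ q₂ (by simpa using h₁))
    · exact Or.inr ⟨rfl, finSigmaFinEquiv_lt_of_lex (Or.inr ⟨rfl, h₁⟩)⟩
  have hφ' : φ = Fin.cast (sum_concatTuple r) := by
    have hs : Function.Surjective φ := by
      have := (Fintype.bijective_iff_injective_and_card φ).2
        ⟨hφ.injective, by simp only [Fintype.card_fin, sum_concatTuple]⟩
      exact this.2
    refine (hφ.range_inj (fun _ _ h => h)).1 ?_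
    rw [hs.range_eq, (Fin.rightInverse_cast (sum_concatTuple r)).surjective.range_eq]
  rw [← congrFun hφ' c]
  let Ψ (t : (a : Fin n) × Fin (∑ b, r a b)) : (a : Fin n) × (b : Fin (k a)) × Fin (r a b) :=
    ⟨t.1, finSigmaFinEquiv.symm t.2⟩
  refine Eq.trans ?_ (congrArg Ψ (Equiv.symm_apply_apply finSigmaFinEquiv _).symm)
  simp only [Ψ, Equiv.symm_apply_apply]

theorem finSigmaFinEquiv_symm_fin_one {m : ℕ} (c : Fin (∑ _ : Fin 1, m)) :
    finSigmaFinEquiv.symm c = ⟨0, Fin.cast (by simp) c⟩ := by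
  rw [Equiv.symm_apply_eq, Fin.ext_iff, finSigmaFinEquiv_one]
  rfl

theorem finSigmaFinEquiv_symm_of_one (c : Fin (∑ _ : Fin n, 1)) :
    finSigmaFinEquiv.symm c = ⟨Fin.cast (by simp) c, 0⟩ := by
  rw [Equiv.symm_apply_eq, Fin.ext_iff, finSigmaFinEquiv_apply]
  simp

end Concat

/-! ### Formal terms and the laws of substitution -/

namespace CatOperad

variable {C : Type w} {O : CatOperad.{w, v, v'} C}

/-- The category of formal operations, with output of colour `j`, applied to objects of `A`. -/
abbrev Term (A : Algebra.{w, v, v', u₁, u₁'} O) (j : C) :=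
  (s : (n : ℕ) × (Fin n → C)) × (O.Op s.2 j × ∀ a, A.obj (s.2 a))

namespace Term

variable (A : Algebra.{w, v, v', u₁, u₁'} O)

/-- The term given by an operation and objects. -/
abbrev mk {n : ℕ} {i : Fin n → C} {j : C} (x : O.Op i j) (d : ∀ a, A.obj (i a)) : Term A j :=
  ⟨⟨n, i⟩, (x, d)⟩

variable {A}

/-- A term records its arity and input word, so the heterogeneous operad laws become ordinary
equalities of terms. -/
theorem mk_eq_mk {n n' : ℕ} (hn : n = n') {i : Fin n → C} {i' : Fin n' → C} {j : C}
    {x : O.Op i j} {x' : O.Op i' j} {d : ∀ a, A.obj (i a)} {d' : ∀ a, A.obj (i' a)}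
    (hx : HEq x x')
    (h : ∀ a, (⟨i a, d a⟩ : (c : C) × A.obj c) = ⟨i' (Fin.cast hn a), d' (Fin.cast hn a)⟩) :
    mk A x d = mk A x' d' := by
  subst hn
  obtain rfl : i = i' := funext fun a => congrArg Sigma.fst (h a)
  obtain rfl : d = d' := funext fun a => eq_of_heq (Sigma.mk.inj (h a)).2
  obtain rfl := eq_of_heq hx
  rfl

theorem one_subst {n : ℕ} {i : Fin n → C} {j : C} (x : O.Op i j) (d : ∀ a, A.obj (i a)) :
    mk A (O.subst (i := fun _ : Fin 1 => j) (O.one j) (fun _ => x)) (concatTuple fun _ => d) =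
      mk A x d :=
  mk_eq_mk (by simp) (O.one_comp_obj i j x) fun a => by
    have h (p q : (_ : Fin 1) × Fin n) (hpq : p = q) :
      (⟨i p.2, d p.2⟩ : (c : C) × A.obj c) = ⟨i q.2, d q.2⟩ := by rw [hpq]
    exact h _ _ (finSigmaFinEquiv_symm_fin_one a)

theorem subst_one {n : ℕ} {i : Fin n → C} {j : C} (x : O.Op i j) (d : ∀ a, A.obj (i a)) :
    mk A (O.subst x (fun a => O.one (i a))) (concatTuple fun a (_ : Fin 1) => d a) =
      mk A x d :=
  mk_eq_mk (by simp) (O.comp_one_obj i j x) fun a => by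
    have h (p q : (_ : Fin n) × Fin 1) (hpq : p = q) :
      (⟨i p.1, d p.1⟩ : (c : C) × A.obj c) = ⟨i q.1, d q.1⟩ := by rw [hpq]
    exact h _ _ (finSigmaFinEquiv_symm_of_one a)

theorem subst_subst {n : ℕ} {i : Fin n → C} {j : C} {k : Fin n → ℕ} {h : ∀ a, Fin (k a) → C}
    {r : ∀ a, Fin (k a) → ℕ} {g : ∀ a b, Fin (r a b) → C}
    (x : O.Op i j) (y : ∀ a, O.Op (h a) (i a)) (z : ∀ a b, O.Op (g a b) (h a b))
    (d : ∀ a b e, A.obj (g a b e)) :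
    mk A (O.subst (O.subst x y) (concatTuple z)) (concatTuple (concatTuple d)) =
      mk A (O.subst x (fun a => O.subst (y a) (z a)))
        (concatTuple (fun a => concatTuple (d a))) :=
  mk_eq_mk (sum_concatTuple r) (O.assoc_obj i j h g x y z) fun c => by
    have h (p q : (a : Fin n) × (b : Fin (k a)) × Fin (r a b)) (hpq : p = q) :
      (⟨g p.1 p.2.1 p.2.2, d p.1 p.2.1 p.2.2⟩ : (c : C) × A.obj c) =
        ⟨g q.1 q.2.1 q.2.2, d q.1 q.2.1 q.2.2⟩ := by rw [hpq]
    exact h _ _ (finSigmaFinEquiv_symm_assoc r c)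

end Term

end CatOperad

namespace CatOperad

variable {C : Type w} {O : CatOperad.{w, v, v'} C}

namespace Term

variable {A : Algebra.{w, v, v', u₁, u₁'} O} (M : Algebra.{w, v, v', u, u'} O)

/-- The evaluation of terms in an algebra, given functors that interpret the objects of `A`. -/
def eval (F : ∀ i, A.obj i ⥤ M.obj i) (j : C) : Term A j ⥤ M.obj j :=
  Sigma.desc fun s => (𝟭 (O.Op s.2 j)).prod (Functor.pi fun a => F (s.2 a)) ⋙ M.act s.2 j

theorem tensor_eq_of_mk_eq (F : ∀ i, A.obj i ⥤ M.obj i) {n n' : ℕ} {i : Fin n → C}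
    {i' : Fin n' → C} {j : C} {x : O.Op i j} {x' : O.Op i' j} {d : ∀ a, A.obj (i a)}
    {d' : ∀ a, A.obj (i' a)} (e : mk A x d = mk A x' d') :
    M.tensor x (fun a => (F (i a)).obj (d a)) = M.tensor x' (fun a => (F (i' a)).obj (d' a)) :=
  congrArg (eval M F j).obj e

variable (A) in
/-- The evaluation of terms on objects of `A` in `A`. -/
abbrev selfEval (j : C) : Term A j ⥤ A.obj j := eval A (fun i => 𝟭 (A.obj i)) j

/-- The morphism of terms given by a morphism of operations and morphisms of objects. -/
abbrev homMk {n : ℕ} {i : Fin n → C} {j : C} {x x' : O.Op i j} {d d' : ∀ a, A.obj (i a)}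
    (q : x ⟶ x') (g : ∀ a, d a ⟶ d' a) : mk A x d ⟶ mk A x' d' :=
  Sigma.SigmaHom.mk (C := fun s : (n : ℕ) × (Fin n → C) => O.Op s.2 j × ∀ a, A.obj (s.2 a))
    (i := ⟨n, i⟩) (Prod.mkHom q g : (x, d) ⟶ (x', d'))

theorem exists_eq_homMk {j : C} {s s' : Term A j} (θ : s ⟶ s') :
    ∃ (k : ℕ) (h : Fin k → C) (y y' : O.Op h j) (d d' : ∀ b, A.obj (h b)) (q : y ⟶ y')
      (g : ∀ b, d b ⟶ d' b), s = mk A y d ∧ s' = mk A y' d' ∧ HEq θ (homMk q g) := by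
  change Sigma.SigmaHom s s' at θ
  cases θ with
  | mk f => exact ⟨_, _, _, _, _, _, f.1, f.2, rfl, rfl, HEq.rfl⟩

/-- A morphism of terms stays in one summand of the disjoint union. Choosing the summands for all
`a` at once lets whole families be replaced by constructors. -/
theorem hom_pi_induction {n : ℕ} {i : Fin n → C}
    {motive : ∀ t t' : ∀ a, Term A (i a), (∀ a, t a ⟶ t' a) → Prop}
    (hm : ∀ {k : Fin n → ℕ} {h : ∀ a, Fin (k a) → C} {y y' : ∀ a, O.Op (h a) (i a)}
      {d d' : ∀ a b, A.obj (h a b)} (q : ∀ a, y a ⟶ y' a) (g : ∀ a b, d a b ⟶ d' a b),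
        motive (fun a => mk A (y a) (d a)) (fun a => mk A (y' a) (d' a))
          (fun a => homMk (q a) (g a)))
    {t t' : ∀ a, Term A (i a)} (ψ : ∀ a, t a ⟶ t' a) : motive t t' ψ := by
  choose k h y y' d d' q g e e' eψ using fun a => exists_eq_homMk (ψ a)
  obtain rfl : t = fun a => mk A (y a) (d a) := funext e
  obtain rfl : t' = fun a => mk A (y' a) (d' a) := funext e'
  obtain rfl : ψ = fun a => homMk (q a) (g a) := funext fun a => eq_of_heq (eψ a)
  exact hm q g

end Term

/-! ### Values of the free lax morphism -/

namespace LaxMor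

section Free

variable {C : Type w} {O : CatOperad.{w, w, w} C} {A : Algebra.{w, w, w, w, w} O}
  {M : Algebra.{w, w, w, u, w} O} [∀ i, HasColimitsOfSize.{w, w} (M.obj i)]
  (F : ∀ i, A.obj i ⥤ M.obj i)

/-- The underlying functors of the free lax morphism. -/
noncomputable def freeF (j : C) : A.obj j ⥤ M.obj j :=
  (Term.selfEval A j).pointwiseLeftKanExtension (Term.eval M F j)

/-- The canonical morphisms to the values of the free lax morphism, indexed by terms. -/
noncomputable def freeιTerm {j : C} (t : Term A j) {c : A.obj j}
    (f : (Term.selfEval A j).obj t ⟶ c) : (Term.eval M F j).obj t ⟶ (freeF F j).obj c :=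
  colimit.ι (CostructuredArrow.proj (Term.selfEval A j) c ⋙ Term.eval M F j)
    (CostructuredArrow.mk f)

/-- The canonical morphisms to the values of the free lax morphism. -/
noncomputable def freeι {n : ℕ} {i : Fin n → C} {j : C} (x : O.Op i j) (d : ∀ a, A.obj (i a))
    {c : A.obj j} (f : A.tensor x d ⟶ c) :
    M.tensor x (fun a => (F (i a)).obj (d a)) ⟶ (freeF F j).obj c :=
  freeιTerm F (Term.mk A x d) f

theorem freeιTerm_natural {j : C} {t t' : Term A j} (θ : t ⟶ t') {c : A.obj j}
    (f : (Term.selfEval A j).obj t' ⟶ c) :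
    (Term.eval M F j).map θ ≫ freeιTerm F t' f =
      freeιTerm F t ((Term.selfEval A j).map θ ≫ f) :=
  colimit.w (CostructuredArrow.proj (Term.selfEval A j) c ⋙ Term.eval M F j)
    (CostructuredArrow.homMk θ rfl :
      CostructuredArrow.mk ((Term.selfEval A j).map θ ≫ f) ⟶ CostructuredArrow.mk f)

theorem freeι_natural {n : ℕ} {i : Fin n → C} {j : C} {x x' : O.Op i j}
    {d d' : ∀ a, A.obj (i a)} (q : x ⟶ x') (g : ∀ a, d a ⟶ d' a) {c : A.obj j}
    (f : A.tensor x' d' ⟶ c) :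
    M.tensorHom q (fun a => (F (i a)).map (g a)) ≫ freeι F x' d' f =
      freeι F x d (A.tensorHom q g ≫ f) :=
  freeιTerm_natural F (Term.homMk q g) f

theorem freeι_map {n : ℕ} {i : Fin n → C} {j : C} (x : O.Op i j) (d : ∀ a, A.obj (i a))
    {c c' : A.obj j} (f : A.tensor x d ⟶ c) (u : c ⟶ c') :
    freeι F x d f ≫ (freeF F j).map u = freeι F x d (f ≫ u) :=
  colimit.ι_desc _ _

/-- This is how the operad laws reach the free lax morphism: equal terms have the same canonical
map, up to transport. -/
theorem freeι_eq_of_mk_eq {n n' : ℕ} {i : Fin n → C} {i' : Fin n' → C} {j : C} {x : O.Op i j}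
    {x' : O.Op i' j} {d : ∀ a, A.obj (i a)} {d' : ∀ a, A.obj (i' a)}
    (e : Term.mk A x d = Term.mk A x' d') {c : A.obj j} {f : A.tensor x d ⟶ c}
    {f' : A.tensor x' d' ⟶ c}
    (hf : f = eqToHom (Term.tensor_eq_of_mk_eq A (fun i => 𝟭 (A.obj i)) e) ≫ f') :
    freeι F x d f = eqToHom (Term.tensor_eq_of_mk_eq M F e) ≫ freeι F x' d' f' := by
  have key {t t' : Term A j} (e : t = t') (f' : (Term.selfEval A j).obj t' ⟶ c) :
      freeιTerm F t (eqToHom (congrArg (Term.selfEval A j).obj e) ≫ f') =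
        eqToHom (congrArg (Term.eval M F j).obj e) ≫ freeιTerm F t' f' := by
    subst e
    simp
  subst hf
  exact key e f'

theorem freeF_hom_ext {j : C} {c : A.obj j} {Z : M.obj j} {u v : (freeF F j).obj c ⟶ Z}
    (h : ∀ {n : ℕ} {i : Fin n → C} (x : O.Op i j) (d : ∀ a, A.obj (i a)) (f : A.tensor x d ⟶ c),
      freeι F x d f ≫ u = freeι F x d f ≫ v) : u = v :=
  colimit.hom_ext fun t => h t.left.2.1 t.left.2.2 t.hom

theorem freeF_exists_desc {j : C} {c : A.obj j} {Z : M.obj j}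
    (φ : ∀ {n : ℕ} {i : Fin n → C} (x : O.Op i j) (d : ∀ a, A.obj (i a)) (_ : A.tensor x d ⟶ c),
      M.tensor x (fun a => (F (i a)).obj (d a)) ⟶ Z)
    (hφ : ∀ {n : ℕ} {i : Fin n → C} {x x' : O.Op i j} {d d' : ∀ a, A.obj (i a)} (q : x ⟶ x')
      (g : ∀ a, d a ⟶ d' a) (f : A.tensor x' d' ⟶ c),
        M.tensorHom q (fun a => (F (i a)).map (g a)) ≫ φ x' d' f = φ x d (A.tensorHom q g ≫ f)) :
    ∃ u : (freeF F j).obj c ⟶ Z,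
      ∀ {n : ℕ} {i : Fin n → C} (x : O.Op i j) (d : ∀ a, A.obj (i a)) (f : A.tensor x d ⟶ c),
        freeι F x d f ≫ u = φ x d f := by
  have key {t t' : Term A j} (θ : t ⟶ t') (f : (Term.selfEval A j).obj t' ⟶ c) :
      (Term.eval M F j).map θ ≫ φ t'.2.1 t'.2.2 f =
        φ t.2.1 t.2.2 ((Term.selfEval A j).map θ ≫ f) := by
    obtain ⟨k, h, y, y', d, d', q, g, rfl, rfl, hθ⟩ := Term.exists_eq_homMk θ
    obtain rfl := eq_of_heq hθ
    exact hφ q g f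
  obtain ⟨u, hu⟩ := (colimit.isColimit (CostructuredArrow.proj (Term.selfEval A j) c ⋙
    Term.eval M F j)).exists_desc (fun t => φ t.left.2.1 t.left.2.2 t.hom) (fun {t t'} θ => by
      refine (key θ.left t'.hom).trans ?_
      exact congrArg (φ t.left.2.1 t.left.2.2) (CostructuredArrow.w θ))
  exact ⟨u, fun x d f => hu (CostructuredArrow.mk (Y := Term.mk A x d) f)⟩

variable (hM : M.IsLocallyPresentable)
include hM

/-- Each variable has its own comma category as index, so the version with independent index
categories is needed here, not the sifted one. -/
theorem nonempty_isColimit_tensor_freeF {n : ℕ} {i : Fin n → C} {j : C} (x : O.Op i j)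
    (c : ∀ a, A.obj (i a)) :
    Nonempty (IsColimit ((M.tensorFunctor x).mapCocone (Cocone.pi fun a =>
      colimit.cocone (CostructuredArrow.proj (Term.selfEval A (i a)) (c a) ⋙
        Term.eval M F (i a))))) :=
  (hM.preservesColimitsSeparately x).nonempty_isColimit_pi _ fun _ => colimit.isColimit _

theorem tensor_freeF_hom_ext {n : ℕ} {i : Fin n → C} {j : C} (x : O.Op i j)
    (c : ∀ a, A.obj (i a)) {Z : M.obj j} {u v : M.tensor x (fun a => (freeF F (i a)).obj (c a)) ⟶ Z}
    (h : ∀ {k : Fin n → ℕ} {h : ∀ a, Fin (k a) → C} (y : ∀ a, O.Op (h a) (i a))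
      (d : ∀ a b, A.obj (h a b)) (f : ∀ a, A.tensor (y a) (d a) ⟶ c a),
        M.tensorHom (𝟙 x) (fun a => freeι F (y a) (d a) (f a)) ≫ u =
          M.tensorHom (𝟙 x) (fun a => freeι F (y a) (d a) (f a)) ≫ v) : u = v :=
  (nonempty_isColimit_tensor_freeF F hM x c).some.hom_ext fun t =>
    h (fun a => (t a).left.2.1) (fun a => (t a).left.2.2) (fun a => (t a).hom)

theorem tensor_freeF_exists_desc {n : ℕ} {i : Fin n → C} {j : C} (x : O.Op i j)
    (c : ∀ a, A.obj (i a)) {Z : M.obj j}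
    (φ : ∀ {k : Fin n → ℕ} {h : ∀ a, Fin (k a) → C} (y : ∀ a, O.Op (h a) (i a))
      (d : ∀ a b, A.obj (h a b)) (_ : ∀ a, A.tensor (y a) (d a) ⟶ c a),
        M.tensor x (fun a => M.tensor (y a) (fun b => (F (h a b)).obj (d a b))) ⟶ Z)
    (hφ : ∀ {k : Fin n → ℕ} {h : ∀ a, Fin (k a) → C} {y y' : ∀ a, O.Op (h a) (i a)}
      {d d' : ∀ a b, A.obj (h a b)} (q : ∀ a, y a ⟶ y' a) (g : ∀ a b, d a b ⟶ d' a b)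
      (f : ∀ a, A.tensor (y' a) (d' a) ⟶ c a),
        M.tensorHom (𝟙 x) (fun a => M.tensorHom (q a) (fun b => (F (h a b)).map (g a b))) ≫
          φ y' d' f = φ y d (fun a => A.tensorHom (q a) (g a) ≫ f a)) :
    ∃ u : M.tensor x (fun a => (freeF F (i a)).obj (c a)) ⟶ Z,
      ∀ {k : Fin n → ℕ} {h : ∀ a, Fin (k a) → C} (y : ∀ a, O.Op (h a) (i a))
        (d : ∀ a b, A.obj (h a b)) (f : ∀ a, A.tensor (y a) (d a) ⟶ c a),
          M.tensorHom (𝟙 x) (fun a => freeι F (y a) (d a) (f a)) ≫ u = φ y d f := by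
  have key {t t' : ∀ a, Term A (i a)} (θ : ∀ a, t a ⟶ t' a)
      (f : ∀ a, (Term.selfEval A (i a)).obj (t' a) ⟶ c a) :
      M.tensorHom (𝟙 x) (fun a => (Term.eval M F (i a)).map (θ a)) ≫
        φ (fun a => (t' a).2.1) (fun a => (t' a).2.2) f =
        φ (fun a => (t a).2.1) (fun a => (t a).2.2)
          (fun a => (Term.selfEval A (i a)).map (θ a) ≫ f a) := by
    induction θ using Term.hom_pi_induction with
    | hm q g => exact hφ q g f
  obtain ⟨u, hu⟩ := (nonempty_isColimit_tensor_freeF F hM x c).some.exists_desc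
    (fun t => φ (fun a => (t a).left.2.1) (fun a => (t a).left.2.2) (fun a => (t a).hom))
    (fun {t t'} θ => by
      refine (key (fun a => (θ a).left) (fun a => (t' a).hom)).trans ?_
      exact congrArg (φ (fun a => (t a).left.2.1) (fun a => (t a).left.2.2))
        (funext fun a => CostructuredArrow.w (θ a)))
  exact ⟨u, fun y d f => hu fun a => CostructuredArrow.mk (Y := Term.mk A (y a) (d a)) (f a)⟩

end Free

end LaxMor

end CatOperad

/-! ### Laxity maps of the free lax morphism -/

theorem concatTuple_surjective {n : ℕ} {k : Fin n → ℕ} {T : ∀ a : Fin n, Fin (k a) → Type*} :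
    Function.Surjective (concatTuple : (∀ a b, T a b) → ∀ c : Fin (∑ a, k a),
      T (finSigmaFinEquiv.symm c).1 (finSigmaFinEquiv.symm c).2) := by
  intro Φ
  let e := Equiv.piCongrLeft (fun p : (a : Fin n) × Fin (k a) => T p.1 p.2) finSigmaFinEquiv.symm
  exact ⟨fun a b => e Φ ⟨a, b⟩, funext fun c => Equiv.piCongrLeft_apply_apply
    (fun p : (a : Fin n) × Fin (k a) => T p.1 p.2) finSigmaFinEquiv.symm Φ c⟩

namespace CatOperad

variable {C : Type w}

namespace Algebra

variable {O : CatOperad.{w, v, v'} C} (M : Algebra.{w, v, v', u, u'} O)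

theorem tensorHom_eqToHom {n : ℕ} {i : Fin n → C} {j : C} (x : O.Op i j) {m m' : ∀ a, M.obj (i a)}
    (h : ∀ a, m a = m' a) :
    M.tensorHom (𝟙 x) (fun a => eqToHom (h a)) =
      eqToHom (congrArg (M.tensor x) (funext h)) := by
  obtain rfl : m = m' := funext h
  exact M.tensorHom_id x m

variable {n : ℕ} {i : Fin n → C} {j : C} {k : Fin n → ℕ} {h : ∀ a, Fin (k a) → C}

theorem tensorHom_tensorHom {x x' : O.Op i j} {y y' : ∀ a, O.Op (h a) (i a)}
    {m m' : ∀ a b, M.obj (h a b)} (p : x ⟶ x') (q : ∀ a, y a ⟶ y' a)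
    (f : ∀ a b, m a b ⟶ m' a b) :
    M.tensorHom p (fun a => M.tensorHom (q a) (f a)) ≫ eqToHom (M.tensor_subst x' y' m').symm =
      eqToHom (M.tensor_subst x y m).symm ≫ M.tensorHom (O.substHom p q) (concatHom f) := by
  rw [tensorHom_subst, eqToHom_trans_assoc, eqToHom_refl, Category.id_comp]

end Algebra

namespace LaxMor

section Free

variable {O : CatOperad.{w, w, w} C} {A : Algebra.{w, w, w, w, w} O}
  {M : Algebra.{w, w, w, u, w} O} [∀ i, HasColimitsOfSize.{w, w} (M.obj i)]
  (F : ∀ i, A.obj i ⥤ M.obj i) (hM : M.IsLocallyPresentable)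
include hM

theorem tensor_freeF_concat_hom_ext {n : ℕ} {k : Fin n → ℕ} {h : ∀ a, Fin (k a) → C} {j : C}
    (x : O.Op (concatTuple h) j) (c : ∀ a b, A.obj (h a b)) {Z : M.obj j}
    {u v : M.tensor x (fun a => (freeF F (concatTuple h a)).obj (concatTuple c a)) ⟶ Z}
    (huv : ∀ {r : ∀ a, Fin (k a) → ℕ} {g : ∀ a b, Fin (r a b) → C}
      (z : ∀ a b, O.Op (g a b) (h a b)) (d : ∀ a b e, A.obj (g a b e))
      (f : ∀ a b, A.tensor (z a b) (d a b) ⟶ c a b),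
        M.tensorHom (𝟙 x) (concatHom fun a b => freeι F (z a b) (d a b) (f a b)) ≫ u =
          M.tensorHom (𝟙 x) (concatHom fun a b => freeι F (z a b) (d a b) (f a b)) ≫ v) :
    u = v := by
  refine tensor_freeF_hom_ext F hM x (concatTuple c) fun {r g} z d f => ?_
  -- All data of a term over `c a b` form one type, so a single use of surjectivity regroups a flat
  -- family of terms.
  let T (a : Fin n) (b : Fin (k a)) := (r : ℕ) × (g : Fin r → C) × (z : O.Op g (h a b)) ×
    (d : ∀ e, A.obj (g e)) × (A.tensor z d ⟶ c a b)
  obtain ⟨φ, hφ⟩ := concatTuple_surjective (T := T) fun a => ⟨r a, g a, z a, d a, f a⟩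
  have key (ψ : ∀ a, T (finSigmaFinEquiv.symm a).1 (finSigmaFinEquiv.symm a).2)
      (hψ : concatTuple φ = ψ) :
      M.tensorHom (𝟙 x) (fun a => freeι F (ψ a).2.2.1 (ψ a).2.2.2.1 (ψ a).2.2.2.2) ≫ u =
        M.tensorHom (𝟙 x) (fun a => freeι F (ψ a).2.2.1 (ψ a).2.2.2.1 (ψ a).2.2.2.2) ≫ v := by
    subst hψ
    exact huv (fun a b => (φ a b).2.2.1) (fun a b => (φ a b).2.2.2.1) (fun a b => (φ a b).2.2.2.2)
  exact key _ hφ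

/-- The component at a tuple of terms `(y, d, f)` goes to the component at the term obtained by
substituting the `y a` into `x`, with structure map `⊗ₓ(f₁, …, fₙ)`. Functoriality of substitution
makes this compatible with morphisms of terms. -/
theorem exists_freeμ {n : ℕ} {i : Fin n → C} {j : C} (x : O.Op i j) (c : ∀ a, A.obj (i a)) :
    ∃ μ : M.tensor x (fun a => (freeF F (i a)).obj (c a)) ⟶ (freeF F j).obj (A.tensor x c),
      ∀ {k : Fin n → ℕ} {h : ∀ a, Fin (k a) → C} (y : ∀ a, O.Op (h a) (i a))
        (d : ∀ a b, A.obj (h a b)) (f : ∀ a, A.tensor (y a) (d a) ⟶ c a),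
          M.tensorHom (𝟙 x) (fun a => freeι F (y a) (d a) (f a)) ≫ μ =
            eqToHom (M.tensor_subst x y (fun a b => (F (h a b)).obj (d a b))).symm ≫
              freeι F (O.subst x y) (concatTuple d)
                (eqToHom (A.tensor_subst x y d) ≫ A.tensorHom (𝟙 x) f) := by
  refine tensor_freeF_exists_desc F hM x c
    (fun {k h} y d f => eqToHom (M.tensor_subst x y (fun a b => (F (h a b)).obj (d a b))).symm ≫
      freeι F (O.subst x y) (concatTuple d)
        (eqToHom (A.tensor_subst x y d) ≫ A.tensorHom (𝟙 x) f))
    fun {k h y y' d d'} q g f => ?_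
  have e₁ := M.tensorHom_tensorHom (𝟙 x) q (fun a b => (F (h a b)).map (g a b))
  have e₂ := freeι_natural F (O.substHom (𝟙 x) q) (concatHom g)
    (eqToHom (A.tensor_subst x y' d') ≫ A.tensorHom (𝟙 x) f)
  refine (Category.assoc _ _ _).symm.trans ((congrArg (· ≫ _) e₁).trans
    ((Category.assoc _ _ _).trans (congrArg (eqToHom _ ≫ ·) (e₂.trans ?_))))
  rw [A.tensorHom_subst]
  simp only [Category.assoc, eqToHom_trans_assoc, eqToHom_refl, Category.id_comp,
    A.tensorHom_comp]

/-- The laxity maps of the free lax morphism. -/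
noncomputable def freeμ {n : ℕ} {i : Fin n → C} {j : C} (x : O.Op i j) (c : ∀ a, A.obj (i a)) :
    M.tensor x (fun a => (freeF F (i a)).obj (c a)) ⟶ (freeF F j).obj (A.tensor x c) :=
  (exists_freeμ F hM x c).choose

theorem freeι_freeμ_id {n : ℕ} {i : Fin n → C} {j : C} (x : O.Op i j) {c : ∀ a, A.obj (i a)}
    {k : Fin n → ℕ} {h : ∀ a, Fin (k a) → C} (y : ∀ a, O.Op (h a) (i a))
    (d : ∀ a b, A.obj (h a b)) (f : ∀ a, A.tensor (y a) (d a) ⟶ c a) :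
    M.tensorHom (𝟙 x) (fun a => freeι F (y a) (d a) (f a)) ≫ freeμ F hM x c =
      eqToHom (M.tensor_subst x y (fun a b => (F (h a b)).obj (d a b))).symm ≫
        freeι F (O.subst x y) (concatTuple d)
          (eqToHom (A.tensor_subst x y d) ≫ A.tensorHom (𝟙 x) f) :=
  (exists_freeμ F hM x c).choose_spec y d f

theorem freeι_freeμ {n : ℕ} {i : Fin n → C} {j : C} {x x' : O.Op i j} (p : x ⟶ x')
    {c : ∀ a, A.obj (i a)} {k : Fin n → ℕ} {h : ∀ a, Fin (k a) → C}
    (y : ∀ a, O.Op (h a) (i a)) (d : ∀ a b, A.obj (h a b))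
    (f : ∀ a, A.tensor (y a) (d a) ⟶ c a) :
    M.tensorHom p (fun a => freeι F (y a) (d a) (f a)) ≫ freeμ F hM x' c =
      eqToHom (M.tensor_subst x y (fun a b => (F (h a b)).obj (d a b))).symm ≫
        freeι F (O.subst x y) (concatTuple d)
          (eqToHom (A.tensor_subst x y d) ≫ A.tensorHom p f) := by
  -- Vary the operation first and apply the canonical maps afterwards. The identities are written as
  -- images of identities under `F` so that `freeι_natural` applies.
  have e₀ : M.tensorHom p (fun a => freeι F (y a) (d a) (f a)) =
      M.tensorHom p (fun a => M.tensorHom (𝟙 (y a)) (fun b => (F (h a b)).map (𝟙 (d a b)))) ≫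
        M.tensorHom (𝟙 x') (fun a => freeι F (y a) (d a) (f a)) := by
    have e (a) : M.tensorHom (𝟙 (y a)) (fun b => (F (h a b)).map (𝟙 (d a b))) =
        𝟙 (M.tensor (y a) fun b => (F (h a b)).obj (d a b)) :=
      (congrArg (M.tensorHom (𝟙 (y a))) (funext fun b => (F (h a b)).map_id (d a b))).trans
        (M.tensorHom_id _ _)
    rw [M.tensorHom_comp, Category.comp_id]
    exact congrArg (M.tensorHom p) (funext fun a =>
      ((congrArg (· ≫ _) (e a)).trans (Category.id_comp _)).symm)
  have e₁ := M.tensorHom_tensorHom p (fun a => 𝟙 (y a))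
    (fun a b => (F (h a b)).map (𝟙 (d a b)))
  have e₂ := freeι_natural F (O.substHom p (fun a => 𝟙 (y a))) (concatHom fun a b => 𝟙 (d a b))
    (eqToHom (A.tensor_subst x' y d) ≫ A.tensorHom (𝟙 x') f)
  rw [e₀, Category.assoc, freeι_freeμ_id]
  refine (Category.assoc _ _ _).symm.trans ((congrArg (· ≫ _) e₁).trans
    ((Category.assoc _ _ _).trans (congrArg (eqToHom _ ≫ ·) (e₂.trans ?_))))
  rw [A.tensorHom_subst]
  simp only [Category.assoc, eqToHom_trans_assoc, eqToHom_refl, Category.id_comp,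
    A.tensorHom_comp, A.tensorHom_id, Category.comp_id]

theorem freeμ_natural {n : ℕ} {i : Fin n → C} {j : C} {x x' : O.Op i j} {c c' : ∀ a, A.obj (i a)}
    (p : x ⟶ x') (g : ∀ a, c a ⟶ c' a) :
    M.tensorHom p (fun a => (freeF F (i a)).map (g a)) ≫ freeμ F hM x' c' =
      freeμ F hM x c ≫ (freeF F j).map (A.tensorHom p g) := by
  refine tensor_freeF_hom_ext F hM x c fun {k h} y d f => ?_
  rw [M.tensorHom_comp_assoc, ← Category.assoc _ (freeμ F hM x c), freeι_freeμ, Category.assoc,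
    freeι_map]
  simp only [freeι_map, Category.id_comp, Category.assoc, freeι_freeμ, A.tensorHom_comp]

/-- Substituting a term into the identity operation returns that term (`Term.one_subst`). -/
theorem freeμ_one {j : C} (c : A.obj j) :
    freeμ F hM (i := fun _ : Fin 1 => j) (O.one j) (fun _ => c) =
      eqToHom ((M.tensor_one ((freeF F j).obj c)).trans
        (congrArg (freeF F j).obj (A.tensor_one c).symm)) := by
  refine tensor_freeF_hom_ext F hM _ _ fun {k h} y d f => ?_
  -- The unit law is stated for constant families, so the families over `Fin 1` are first made
  -- constant.
  obtain ⟨k, rfl⟩ : ∃ k', k = fun _ => k' := ⟨k 0, funext fun a => by rw [Subsingleton.elim a 0]⟩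
  obtain ⟨h, rfl⟩ : ∃ h', h = fun _ => h' := ⟨h 0, funext fun a => by rw [Subsingleton.elim a 0]⟩
  obtain ⟨y, rfl⟩ : ∃ y', y = fun _ => y' := ⟨y 0, funext fun a => by rw [Subsingleton.elim a 0]⟩
  obtain ⟨d, rfl⟩ : ∃ d', d = fun _ => d' := ⟨d 0, funext fun a => by rw [Subsingleton.elim a 0]⟩
  obtain ⟨f, rfl⟩ : ∃ f', f = fun _ => f' := ⟨f 0, funext fun a => by rw [Subsingleton.elim a 0]⟩
  have e₁ := freeι_freeμ_id F hM (O.one j) (fun _ : Fin 1 => y) (fun _ => d) (fun _ => f)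
  have e₃ := M.tensorHom_one (freeι F y d f)
  have e₄ := freeι_map F y d f (eqToHom (A.tensor_one c).symm)
  rw [eqToHom_map] at e₄
  have e₅ := freeι_eq_of_mk_eq F (Term.one_subst y d)
    (f := eqToHom (A.tensor_subst (O.one j) (fun _ : Fin 1 => y) fun _ => d) ≫
      A.tensorHom (𝟙 (O.one j)) fun _ => f) (f' := f ≫ eqToHom (A.tensor_one c).symm) (by
    rw [A.tensorHom_one, eqToHom_trans_assoc])
  refine e₁.trans (Eq.trans (congrArg (eqToHom _ ≫ ·) e₅) ?_)
  refine Eq.trans ?_ (congrArg (· ≫ eqToHom _) e₃).symm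
  rw [← e₄]
  simp only [eqToHom_trans_assoc, eqToHom_trans, Category.assoc]

/-- On the component at `(z, d, f)` the two sides are the canonical maps of the two iterated
substitutions of `x`, `y`, `z`, which agree by `Term.subst_subst`. -/
theorem freeμ_subst {n : ℕ} {i : Fin n → C} {j : C} {k : Fin n → ℕ} {h : ∀ a, Fin (k a) → C}
    (x : O.Op i j) (y : ∀ a, O.Op (h a) (i a)) (c : ∀ a b, A.obj (h a b)) :
    freeμ F hM (O.subst x y) (concatTuple c) =
      eqToHom (M.tensor_subst x y (fun a b => (freeF F (h a b)).obj (c a b))) ≫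
        M.tensorHom (𝟙 x) (fun a => freeμ F hM (y a) (c a)) ≫
          freeμ F hM x (fun a => A.tensor (y a) (c a)) ≫
            eqToHom (congrArg (freeF F j).obj (A.tensor_subst x y c).symm) := by
  refine tensor_freeF_concat_hom_ext F hM _ _ fun {r g} z d f => ?_
  have e₁ := freeι_freeμ_id F hM (O.subst x y) (concatTuple z) (concatTuple d) (concatHom f)
  have e₃ := M.tensorHom_subst_id x y (fun a b => freeι F (z a b) (d a b) (f a b))
  have h' (a : Fin n) :=
    (M.tensor_subst (y a) (z a) (fun b e => (F (g a b e)).obj (d a b e))).symm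
  have e₄ : M.tensorHom (𝟙 x) (fun a => M.tensorHom (𝟙 (y a))
        (fun b => freeι F (z a b) (d a b) (f a b))) ≫
        M.tensorHom (𝟙 x) (fun a => freeμ F hM (y a) (c a)) =
      eqToHom (congrArg (M.tensor x) (funext h')) ≫
        M.tensorHom (𝟙 x) (fun a => freeι F (O.subst (y a) (z a)) (concatTuple (d a))
          (eqToHom (A.tensor_subst (y a) (z a) (d a)) ≫ A.tensorHom (𝟙 (y a)) (f a))) := by
    rw [M.tensorHom_comp, ← M.tensorHom_eqToHom x h', M.tensorHom_comp]
    exact congrArg (M.tensorHom (𝟙 x ≫ 𝟙 x)) (funext fun a => freeι_freeμ_id F hM _ _ _ _)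
  have e₅ := freeι_freeμ_id F hM x (fun a => O.subst (y a) (z a)) (fun a => concatTuple (d a))
    (fun a => eqToHom (A.tensor_subst (y a) (z a) (d a)) ≫ A.tensorHom (𝟙 (y a)) (f a))
  have e₆ := freeι_map F (O.subst x (fun a => O.subst (y a) (z a)))
    (concatTuple (fun a => concatTuple (d a)))
    (eqToHom (A.tensor_subst x (fun a => O.subst (y a) (z a)) (fun a => concatTuple (d a))) ≫
      A.tensorHom (𝟙 x) (fun a => eqToHom (A.tensor_subst (y a) (z a) (d a)) ≫
        A.tensorHom (𝟙 (y a)) (f a)))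
    (eqToHom (A.tensor_subst x y c).symm)
  rw [eqToHom_map] at e₆
  have e₂ := freeι_eq_of_mk_eq F (Term.subst_subst x y z d)
    (f := eqToHom (A.tensor_subst (O.subst x y) (concatTuple z) (concatTuple d)) ≫
      A.tensorHom (𝟙 (O.subst x y)) (concatHom f))
    (f' := (eqToHom (A.tensor_subst x (fun a => O.subst (y a) (z a)) (fun a => concatTuple (d a))) ≫
      A.tensorHom (𝟙 x) (fun a => eqToHom (A.tensor_subst (y a) (z a) (d a)) ≫
        A.tensorHom (𝟙 (y a)) (f a))) ≫ eqToHom (A.tensor_subst x y c).symm) (by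
    have e₇ := A.tensorHom_subst_id x y f
    have e₈ := A.tensorHom_comp (𝟙 x) (𝟙 x)
      (fun a => eqToHom (A.tensor_subst (y a) (z a) (d a)))
      (fun a => A.tensorHom (𝟙 (y a)) (f a))
    rw [Category.comp_id, A.tensorHom_eqToHom] at e₈
    rw [← e₈]
    rw [← cancel_mono (eqToHom (A.tensor_subst x y c))]
    refine (Category.assoc _ _ _).trans ((congrArg (eqToHom _ ≫ ·) e₇).trans ?_)
    simp only [Category.assoc, eqToHom_trans, eqToHom_trans_assoc, eqToHom_refl,
      Category.comp_id])
  refine e₁.trans ((congrArg (eqToHom _ ≫ ·) e₂).trans ?_)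
  refine Eq.trans ?_ ((Category.assoc _ _ _).symm.trans ((congrArg (· ≫ _) e₃).trans
    (Category.assoc _ _ _))).symm
  rw [reassoc_of% e₄, reassoc_of% e₅, e₆]
  simp only [eqToHom_trans_assoc]

end Free

end LaxMor

end CatOperad

/-! ### The free–forgetful adjunction -/

namespace CatOperad

variable {C : Type w}

namespace LaxMor

section Free

variable {O : CatOperad.{w, w, w} C} {A : Algebra.{w, w, w, w, w} O}
  {M : Algebra.{w, w, w, u, w} O} [∀ i, HasColimitsOfSize.{w, w} (M.obj i)]
  (F : ∀ i, A.obj i ⥤ M.obj i)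

/-- The unit of the adjunction between free and underlying lax morphisms. -/
noncomputable def freeUnit (i : C) : F i ⟶ freeF F i where
  app c := eqToHom (M.tensor_one _).symm ≫
    freeι F (O.one i) (fun _ : Fin 1 => c) (eqToHom (A.tensor_one c))
  naturality c c' g := by
    have h₁ := freeι_natural F (𝟙 (O.one i)) (fun _ : Fin 1 => g) (eqToHom (A.tensor_one c'))
    rw [M.tensorHom_one, A.tensorHom_one] at h₁
    have h₂ := freeι_map F (O.one i) (fun _ : Fin 1 => c) (eqToHom (A.tensor_one c)) g
    simp only [Category.assoc, eqToHom_trans, eqToHom_refl, Category.comp_id] at h₁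
    rw [Category.assoc, h₂, ← h₁, eqToHom_trans_assoc, eqToHom_refl, Category.id_comp]

theorem freeUnit_app (i : C) (c : A.obj i) :
    (freeUnit F i).app c = eqToHom (M.tensor_one _).symm ≫
      freeι F (O.one i) (fun _ : Fin 1 => c) (eqToHom (A.tensor_one c)) :=
  rfl

variable (hM : M.IsLocallyPresentable)

/-- The free lax morphism. -/
noncomputable def free : LaxMor A M :=
  ofμ (freeF F) (freeμ F hM) (freeμ_natural F hM) (freeμ_one F hM) (freeμ_subst F hM)

/-- Substituting identity operations into `x` returns `x` (`Term.subst_one`). Hence all canonical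
maps come from the unit, the laxity maps and functoriality, which gives uniqueness in the universal
property. -/
theorem freeUnit_freeμ {n : ℕ} {i : Fin n → C} {j : C} (x : O.Op i j) (d : ∀ a, A.obj (i a)) :
    M.tensorHom (𝟙 x) (fun a => (freeUnit F (i a)).app (d a)) ≫ freeμ F hM x d =
      freeι F x d (𝟙 (A.tensor x d)) := by
  have h' (a : Fin n) := (M.tensor_one ((F (i a)).obj (d a))).symm
  have e₁ : M.tensorHom (𝟙 x) (fun a => (freeUnit F (i a)).app (d a)) =
      eqToHom (congrArg (M.tensor x) (funext h')) ≫
        M.tensorHom (𝟙 x) (fun a => freeι F (O.one (i a)) (fun _ : Fin 1 => d a)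
          (eqToHom (A.tensor_one (d a)))) := by
    rw [← M.tensorHom_eqToHom x h', M.tensorHom_comp, Category.comp_id]
    rfl
  have e₂ := freeι_freeμ_id F hM x (fun a => O.one (i a)) (fun a (_ : Fin 1) => d a)
    (fun a => eqToHom (A.tensor_one (d a)))
  have e₃ := freeι_eq_of_mk_eq F (Term.subst_one x d)
    (f := eqToHom (A.tensor_subst x (fun a => O.one (i a)) (fun a (_ : Fin 1) => d a)) ≫
      A.tensorHom (𝟙 x) (fun a => eqToHom (A.tensor_one (d a)))) (f' := 𝟙 _) (by
    rw [A.tensorHom_eqToHom, eqToHom_trans]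
    exact (Category.comp_id _).symm)
  rw [e₁, Category.assoc, e₂]
  refine (congrArg (fun f => _ ≫ _ ≫ f) e₃).trans ?_
  simp only [eqToHom_trans_assoc, eqToHom_refl, Category.id_comp]

variable {F} {Q : LaxMor A M} (σ : ∀ i, F i ⟶ Q.F i)

theorem exists_freeF_desc_app {j : C} (c : A.obj j) :
    ∃ u : (freeF F j).obj c ⟶ (Q.F j).obj c,
      ∀ {n : ℕ} {i : Fin n → C} (x : O.Op i j) (d : ∀ a, A.obj (i a)) (f : A.tensor x d ⟶ c),
        freeι F x d f ≫ u =
          M.tensorHom (𝟙 x) (fun a => (σ (i a)).app (d a)) ≫ Q.μ x d ≫ (Q.F j).map f := by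
  refine freeF_exists_desc F (fun {n i} x d f =>
    M.tensorHom (𝟙 x) (fun a => (σ (i a)).app (d a)) ≫ Q.μ x d ≫ (Q.F j).map f)
    fun {n i x x' d d'} q g f => ?_
  rw [Functor.map_comp, ← Category.assoc (Q.μ x d), ← Q.μ_natural, Category.assoc,
    M.tensorHom_comp_assoc, M.tensorHom_comp_assoc]
  simp only [Category.id_comp, Category.comp_id, NatTrans.naturality]

/-- The natural transformations from the free lax morphism given by the universal property. -/
noncomputable def freeFDesc (j : C) : freeF F j ⟶ Q.F j where
  app c := (exists_freeF_desc_app σ c).choose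
  naturality c c' g := freeF_hom_ext F fun x d f => by
    rw [← Category.assoc, freeι_map, (exists_freeF_desc_app σ c').choose_spec,
      reassoc_of% ((exists_freeF_desc_app σ c).choose_spec x d f)]
    simp only [Functor.map_comp]

theorem freeι_freeFDesc {n : ℕ} {i : Fin n → C} {j : C} (x : O.Op i j) (d : ∀ a, A.obj (i a))
    {c : A.obj j} (f : A.tensor x d ⟶ c) :
    freeι F x d f ≫ (freeFDesc σ j).app c =
      M.tensorHom (𝟙 x) (fun a => (σ (i a)).app (d a)) ≫ Q.μ x d ≫ (Q.F j).map f :=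
  (exists_freeF_desc_app σ c).choose_spec x d f

theorem freeUnit_freeFDesc (i : C) : freeUnit F i ≫ freeFDesc σ i = σ i := by
  ext c
  rw [NatTrans.comp_app, freeUnit_app, Category.assoc, freeι_freeFDesc, Q.μ_one,
    M.tensorHom_one, eqToHom_map]
  simp

/-- On the component at `(y, d, f)` this is the compatibility of the laxity maps of `Q` with
substitution, together with their naturality in `f`. -/
theorem freeμ_freeFDesc {n : ℕ} {i : Fin n → C} {j : C} (x : O.Op i j) (c : ∀ a, A.obj (i a)) :
    freeμ F hM x c ≫ (freeFDesc σ j).app (A.tensor x c) =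
      M.tensorHom (𝟙 x) (fun a => (freeFDesc σ (i a)).app (c a)) ≫ Q.μ x c := by
  refine tensor_freeF_hom_ext F hM x c fun {k h} y d f => ?_
  have e₁ := freeι_freeμ_id F hM x y d f
  have e₂ := freeι_freeFDesc σ (O.subst x y) (concatTuple d)
    (eqToHom (A.tensor_subst x y d) ≫ A.tensorHom (𝟙 x) f)
  have e₃ := M.tensorHom_subst_id x y (fun a b => (σ (h a b)).app (d a b))
  have e₄ := Q.μ_subst x y d
  have e₅ := Q.μ_natural (𝟙 x) f
  have e₆ : M.tensorHom (𝟙 x) (fun a => freeι F (y a) (d a) (f a)) ≫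
      M.tensorHom (𝟙 x) (fun a => (freeFDesc σ (i a)).app (c a)) =
      M.tensorHom (𝟙 x) (fun a => M.tensorHom (𝟙 (y a)) (fun b => (σ (h a b)).app (d a b))) ≫
        M.tensorHom (𝟙 x) (fun a => Q.μ (y a) (d a)) ≫
          M.tensorHom (𝟙 x) (fun a => (Q.F (i a)).map (f a)) := by
    rw [M.tensorHom_comp, M.tensorHom_comp, M.tensorHom_comp]
    simp only [freeι_freeFDesc, Category.comp_id]
  rw [reassoc_of% e₁, reassoc_of% e₆, e₅]
  refine (congrArg (eqToHom _ ≫ ·) e₂).trans ?_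
  rw [Functor.map_comp, eqToHom_map]
  have e₇ : M.tensorHom (𝟙 (O.subst x y)) (concatHom fun a b => (σ (h a b)).app (d a b)) ≫
      Q.μ (O.subst x y) (concatTuple d) =
      eqToHom (M.tensor_subst x y (fun a b => (F (h a b)).obj (d a b))) ≫
        M.tensorHom (𝟙 x) (fun a => M.tensorHom (𝟙 (y a)) (fun b => (σ (h a b)).app (d a b))) ≫
          M.tensorHom (𝟙 x) (fun a => Q.μ (y a) (d a)) ≫
            Q.μ x (fun a => A.tensor (y a) (d a)) ≫
              eqToHom (congrArg (Q.F j).obj (A.tensor_subst x y d).symm) := by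
    rw [e₄]
    exact (Category.assoc _ _ _).symm.trans ((congrArg (· ≫ _) e₃).trans (Category.assoc _ _ _))
  refine (congrArg (eqToHom _ ≫ ·) ((Category.assoc _ _ _).symm.trans
    (congrArg (· ≫ _) e₇))).trans ?_
  simp only [Category.assoc, eqToHom_trans_assoc, eqToHom_refl, Category.id_comp]

/-- The morphism from the free lax morphism given by the universal property. -/
noncomputable def freeDesc : free F hM ⟶ Q :=
  homMk (freeFDesc σ) (freeμ_freeFDesc hM σ)

theorem free_hom_ext {s t : free F hM ⟶ Q}
    (h : ∀ i, freeUnit F i ≫ Hom.σ s i = freeUnit F i ≫ Hom.σ t i) : s = t := by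
  have key (s : ∀ i, freeF F i ⟶ Q.F i)
      (hs : ∀ {n : ℕ} {i : Fin n → C} {j : C} (x : O.Op i j) (c : ∀ a, A.obj (i a)),
        freeμ F hM x c ≫ (s j).app (A.tensor x c) =
          M.tensorHom (𝟙 x) (fun a => (s (i a)).app (c a)) ≫ Q.μ x c)
      {n : ℕ} {i : Fin n → C} {j : C} (x : O.Op i j) (d : ∀ a, A.obj (i a)) {c : A.obj j}
      (f : A.tensor x d ⟶ c) :
      freeι F x d f ≫ (s j).app c =
        M.tensorHom (𝟙 x) (fun a => (freeUnit F (i a) ≫ s (i a)).app (d a)) ≫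
          Q.μ x d ≫ (Q.F j).map f := by
    have e := freeι_map F x d (𝟙 _) f
    rw [Category.id_comp] at e
    rw [← e, Category.assoc, NatTrans.naturality, ← freeUnit_freeμ F hM x d, Category.assoc,
      reassoc_of% (hs x d), M.tensorHom_comp_assoc, Category.comp_id]
    simp only [NatTrans.comp_app]
  refine hom_ext fun j c => freeF_hom_ext F fun x d f => ?_
  refine (key (Hom.σ s) (Hom.μ_comm s) x d f).trans
    (Eq.trans ?_ (key (Hom.σ t) (Hom.μ_comm t) x d f).symm)
  simp only [h]

variable (A) in
/-- Lax morphisms out of the free lax morphism. -/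
noncomputable def freeHomEquiv (F : ∀ i, A.obj i ⥤ M.obj i) (Q : LaxMor A M) :
    (free F hM ⟶ Q) ≃ (F ⟶ (forget A M).obj Q) where
  toFun s i := freeUnit F i ≫ Hom.σ s i
  invFun σ := freeDesc hM σ
  left_inv s := free_hom_ext hM fun i =>
    freeUnit_freeFDesc (fun i => freeUnit F i ≫ Hom.σ s i) i
  right_inv σ := funext fun i => freeUnit_freeFDesc σ i

variable (A) in
/-- The functor of free lax morphisms. -/
noncomputable def freeFunctor : (∀ i, A.obj i ⥤ M.obj i) ⥤ LaxMor A M :=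
  Adjunction.leftAdjointOfEquiv (G := forget A M) (freeHomEquiv A hM)
    fun F _ _ s t => funext fun i => (Category.assoc (freeUnit F i) (Hom.σ t i) (Hom.σ s i)).symm

variable (A) in
/-- Free lax morphisms are left adjoint to the forgetful functor. -/
noncomputable def freeAdjunction : freeFunctor A hM ⊣ forget A M :=
  Adjunction.adjunctionOfEquivLeft _ _

end Free

end LaxMor

end CatOperad

/-! ### Criteria for cocompleteness and local presentability -/

namespace CategoryTheory

theorem Monad.preservesColimitOfIsReflexivePair {D : Type u} [Category.{v} D] {B : Type u₁}
    [Category.{v} B] (G : D ⥤ B) [PreservesColimitsOfShape WalkingReflexivePair G] :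
    Monad.PreservesColimitOfIsReflexivePair G where
  out _ _ f g _ :=
    preservesColimit_of_iso_diagram G (inclusionWalkingReflexivePairOfIsReflexivePairIso f g)

theorem Functor.preservesColimitsOfShape_whiskeringRight {D B : Type*} [Category* D] [Category* B]
    (G : D ⥤ B) (J K : Type*) [Category* J] [Category* K] [HasColimitsOfShape K D]
    [PreservesColimitsOfShape K G] :
    PreservesColimitsOfShape K ((Functor.whiskeringRight J D B).obj G) :=
  preservesColimitsOfShape_of_evaluation _ _ fun j =>
    preservesColimitsOfShape_of_natIso
      (Iso.refl ((evaluation J D).obj j ⋙ G) : _ ≅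
        (Functor.whiskeringRight J D B).obj G ⋙ (evaluation J B).obj j)

/-- If `D` has reflexive coequalizers and a conservative right adjoint functor to `B` that preserves
them, then it has all colimits which `B` has. -/
theorem Adjunction.hasColimitsOfShape_of_reflexiveCoequalizers {D : Type u} [Category.{w} D]
    {B : Type u₁} [Category.{w} B] {L : B ⥤ D} {G : D ⥤ B} (adj : L ⊣ G)
    [HasColimitsOfShape WalkingReflexivePair D] [PreservesColimitsOfShape WalkingReflexivePair G]
    [G.ReflectsIsomorphisms] (J : Type w) [SmallCategory J] [HasColimitsOfShape J B] :
    HasColimitsOfShape J D := by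
  let U := (Functor.whiskeringRight J D B).obj G
  have := G.preservesColimitsOfShape_whiskeringRight J WalkingReflexivePair
  have := Monad.preservesColimitOfIsReflexivePair U
  have := (hasReflexiveCoequalizers_iff (C := D)).1 inferInstance
  have := (hasReflexiveCoequalizers_iff (C := J ⥤ D)).1 inferInstance
  -- Postcomposition with `G` on `J`-diagrams inherits the hypotheses of the crude monadicity
  -- theorem. Constant diagrams followed by `U` amount to `G` followed by constant diagrams, which
  -- is a right adjoint, so the adjoint triangle theorem lifts a left adjoint to the constant
  -- diagram functor of `D`.
  let : MonadicRightAdjoint U :=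
    Monad.monadicOfHasPreservesReflexiveCoequalizersOfReflectsIsomorphisms (adj.whiskerRight J)
  have : (Functor.const J ⋙ U).IsRightAdjoint :=
    ((colimConstAdj.comp adj).ofNatIsoRight (Functor.compConstIso J G)).isRightAdjoint
  exact hasColimitsOfShape_iff_isRightAdjoint_const.2 (isRightAdjoint_triangle_lift_monadic U)

/-- A cocomplete category is locally presentable if it has a small jointly faithful and jointly
conservative family of finitary right adjoint functors to locally presentable categories. -/
theorem isLocallyPresentable_of_isRightAdjoint {D : Type u} [Category.{w} D]
    [HasColimitsOfSize.{w, w} D] {K : Type w} {E : K → Type u₁} [∀ k, Category.{w} (E k)]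
    [∀ k, IsLocallyPresentable.{w} (E k)] (V : ∀ k, D ⥤ E k) [∀ k, (V k).IsRightAdjoint]
    [∀ k, PreservesFilteredColimitsOfSize.{w, w} (V k)]
    (hV : ∀ {X Y : D} (f g : X ⟶ Y), (∀ k, (V k).map f = (V k).map g) → f = g)
    (hV' : ∀ {X Y : D} (f : X ⟶ Y), (∀ k, IsIso ((V k).map f)) → IsIso f) :
    IsLocallyPresentable.{w} D := by
  choose κ hκ hE using fun k => IsLocallyPresentable.exists_cardinal.{w} (E k)
  -- As `K` is small, one regular cardinal exceeds all `κ k` and serves every `E k`.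
  obtain ⟨κ', hκ', h⟩ := HasCardinalLT.exists_regular_cardinal_forall.{w}
    fun k => (κ k).ord.ToType
  have : Fact κ'.IsRegular := ⟨hκ'⟩
  have hE' (k : K) : IsCardinalLocallyPresentable (E k) κ' :=
    IsCardinalLocallyPresentable.of_le (E k) (κ := κ k)
      (le_of_lt (by simpa [hasCardinalLT_iff_cardinal_mk_lt] using h k))
  choose P hP hP₁ hP₂ using
    fun k => (IsCardinalLocallyPresentable.iff_exists_isStrongGenerator (E k) κ').1 (hE' k)
  have hV'' (k : K) : (V k).IsCardinalAccessible κ' :=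
    ⟨fun J _ _ => by
      have := isFiltered_of_isCardinalFiltered J κ'
      infer_instance⟩
  refine ⟨κ', inferInstance, (IsCardinalLocallyPresentable.iff_exists_isStrongGenerator D κ').2
    -- The generator consists of the images of the generators of all `E k` under the left adjoints.
    -- They are presentable because every `V k` is accessible.
    ⟨.ofObj fun T : (k : K) × Subtype (P k) => (V T.1).leftAdjoint.obj T.2.1, inferInstance,
      ObjectProperty.isStrongGenerator_iff.2 ⟨?_, ?_⟩, ?_⟩⟩
  · intro X Y f g hfg
    refine hV f g fun k => (hP₁ k).isSeparating _ _ fun G hG s => ?_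
    have e := hfg _ (ObjectProperty.ofObj_apply _ (⟨k, G, hG⟩ : (k : K) × Subtype (P k)))
      (((Adjunction.ofIsRightAdjoint (V k)).homEquiv G X).symm s)
    have e' := congrArg ((Adjunction.ofIsRightAdjoint (V k)).homEquiv G Y) e
    simpa only [Adjunction.homEquiv_naturality_right, Equiv.apply_symm_apply] using e'
  · intro X Y i _ hi
    refine hV' i fun k => (hP₁ k).isIso_of_mono _ fun G hG s => ?_
    obtain ⟨t, ht⟩ := hi _
      (ObjectProperty.ofObj_apply _ (⟨k, G, hG⟩ : (k : K) × Subtype (P k)))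
      (((Adjunction.ofIsRightAdjoint (V k)).homEquiv G Y).symm s)
    refine ⟨(Adjunction.ofIsRightAdjoint (V k)).homEquiv G X t, ?_⟩
    have e' := congrArg ((Adjunction.ofIsRightAdjoint (V k)).homEquiv G Y) ht
    simpa only [Adjunction.homEquiv_naturality_right, Equiv.apply_symm_apply] using e'
  · rintro _ ⟨k, G, hG⟩
    have : IsCardinalPresentable G κ' := hP₂ k G hG
    exact (Adjunction.ofIsRightAdjoint (V k)).isCardinalPresentable_leftAdjoint_obj κ' G

theorem Pi.isRightAdjoint_eval {I : Type w} {B : I → Type u} [∀ i, Category.{v} (B i)]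
    [∀ i, HasColimitsOfSize.{w, w} (B i)] (i : I) : (Pi.eval B i).IsRightAdjoint := by
  have (X : B i) : HasInitial (StructuredArrow X (Pi.eval B i)) := by
    -- The left adjoint places `X` in position `i` and initial objects elsewhere; the coproduct over
    -- proofs of `i = k` describes both cases at once.
    let Z (k : I) (h : ULift.{w} (PLift (i = k))) : B k := h.down.down ▸ X
    let T (k : I) : B k := ∐ Z k
    let η : X ⟶ T i := Sigma.ι (Z i) ⟨⟨rfl⟩⟩
    have desc {Y : ∀ k, B k} (f : X ⟶ Y i) (k : I) : ∃ g : T k ⟶ Y k,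
        ∀ h : i = k, Sigma.ι (Z k) ⟨⟨h⟩⟩ ≫ g = by subst h; exact f :=
      ⟨Limits.Sigma.desc fun h => by obtain ⟨⟨rfl⟩⟩ := h; exact f, fun h => by subst h; simp⟩
    have ext {Y : ∀ k, B k} {f g : T ⟶ Y} (hfg : η ≫ f i = η ≫ g i) : f = g := by
      funext k
      refine Sigma.hom_ext _ _ fun h => ?_
      obtain ⟨⟨rfl⟩⟩ := h
      exact hfg
    have (Y : StructuredArrow X (Pi.eval B i)) :
        Nonempty (Unique (StructuredArrow.mk (S := X) (T := Pi.eval B i) (Y := T) η ⟶ Y)) := by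
      choose g hg using desc Y.hom
      exact ⟨⟨⟨StructuredArrow.homMk g (hg i rfl)⟩, fun s => StructuredArrow.hom_ext _ _
        (ext ((StructuredArrow.w s).trans (hg i rfl).symm))⟩⟩
    exact (IsInitial.ofUnique (h := fun Y => (this Y).some) _).hasInitial
  exact isRightAdjointOfStructuredArrowInitials _

end CategoryTheory

/-! ### Monadicity and local presentability of lax morphisms -/

namespace CatOperad

variable {C : Type w}

theorem Algebra.IsLocallyPresentable.hasColimitsOfSize {O : CatOperad.{w, v, v'} C}
    {M : Algebra.{w, v, v', u, u'} O} (hM : M.IsLocallyPresentable) (i : C) :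
    HasColimitsOfSize.{w, w} (M.obj i) := by
  have := hM.locallyPresentable
  obtain ⟨κ, _, _⟩ := IsLocallyPresentable.exists_cardinal (M.obj i)
  infer_instance

namespace LaxMor

section Sifted

variable {O : CatOperad.{w, v, v'} C} {A : Algebra.{w, v, v', u₁, u₁'} O}
  {M : Algebra.{w, v, v', u, u'} O}

variable (A) in
theorem hasColimitsOfShape_of_isSifted (hM : M.IsLocallyPresentable) (J : Type w) [SmallCategory J]
    [IsSifted J] : HasColimitsOfShape J (LaxMor A M) where
  has_colimit D := by
    obtain ⟨t, ⟨ht⟩, _⟩ := exists_isColimit_of_isSifted hM D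
    exact ⟨⟨t, ht⟩⟩

variable (A) in
theorem preservesColimitsOfShape_forget (hM : M.IsLocallyPresentable) (J : Type w)
    [SmallCategory J] [IsSifted J] : PreservesColimitsOfShape J (forget A M) where
  preservesColimit {D} := by
    obtain ⟨t, ⟨ht⟩, ht'⟩ := exists_isColimit_of_isSifted hM D
    exact preservesColimit_of_preserves_colimit_cocone ht (nonempty_isColimit_forget t ht').some

variable (A) in
theorem preservesColimitsOfShape_value (hM : M.IsLocallyPresentable) (J : Type w)
    [SmallCategory J] [IsSifted J] (i : C) (c : A.obj i) :
    PreservesColimitsOfShape J (value A M i c) where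
  preservesColimit {D} := by
    obtain ⟨t, ⟨ht⟩, ht'⟩ := exists_isColimit_of_isSifted hM D
    exact preservesColimit_of_preserves_colimit_cocone ht (ht' i c).some

theorem isIso_of_isIso_value {P Q : LaxMor A M} (s : P ⟶ Q)
    (h : ∀ i c, IsIso ((value A M i c).map s)) : IsIso s := by
  have h₁ (i : C) : IsIso (Hom.σ s i) := by
    have (c : A.obj i) : IsIso ((Hom.σ s i).app c) := h i c
    exact NatIso.isIso_of_isIso_app (Hom.σ s i)
  choose τ h₂ h₃ using fun i => (h₁ i).out
  have : IsIso ((forget A M).map s) := ⟨τ, funext h₂, funext h₃⟩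
  exact isIso_of_reflects_iso s (forget A M)

end Sifted

section LocallyPresentable

variable {O : CatOperad.{w, w, w} C} {A : Algebra.{w, w, w, w, w} O}
  {M : Algebra.{w, w, w, u, w} O} (hM : M.IsLocallyPresentable)
include hM

variable (A) in
theorem hasColimitsOfShape_walkingReflexivePair :
    HasColimitsOfShape WalkingReflexivePair (LaxMor A M) := by
  have : IsSifted (AsSmall.{w} WalkingReflexivePair) :=
    IsSifted.isSifted_iff_asSmallIsSifted.1 inferInstance
  have := hasColimitsOfShape_of_isSifted A hM (AsSmall.{w} WalkingReflexivePair)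
  exact hasColimitsOfShape_of_equivalence (AsSmall.equiv (C := WalkingReflexivePair)).symm

variable (A) in
theorem preservesColimitsOfShape_walkingReflexivePair_forget :
    PreservesColimitsOfShape WalkingReflexivePair (forget A M) := by
  have : IsSifted (AsSmall.{w} WalkingReflexivePair) :=
    IsSifted.isSifted_iff_asSmallIsSifted.1 inferInstance
  have := preservesColimitsOfShape_forget A hM (AsSmall.{w} WalkingReflexivePair)
  exact preservesColimitsOfShape_of_equiv (AsSmall.equiv (C := WalkingReflexivePair)).symm _

/-- Crude monadicity theorem: `forget` is conservative, and reflexive coequalizers exist and are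
preserved because they are sifted colimits. -/
theorem isEquivalence_comparison {L : (∀ i, A.obj i ⥤ M.obj i) ⥤ LaxMor A M}
    (adj : L ⊣ forget A M) : (Monad.comparison adj).IsEquivalence := by
  have := hasColimitsOfShape_walkingReflexivePair A hM
  have := preservesColimitsOfShape_walkingReflexivePair_forget A hM
  have := (hasReflexiveCoequalizers_iff (C := LaxMor A M)).1 inferInstance
  have := Monad.preservesColimitOfIsReflexivePair (forget A M)
  exact (Monad.monadicOfHasPreservesReflexiveCoequalizersOfReflectsIsomorphisms adj).eqv

theorem preservesFilteredColimits_toMonad {L : (∀ i, A.obj i ⥤ M.obj i) ⥤ LaxMor A M}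
    (adj : L ⊣ forget A M) :
    PreservesFilteredColimitsOfSize.{w, w} adj.toMonad.toFunctor where
  preserves_filtered_colimits J _ _ := by
    have : IsSifted J := IsFiltered.isSifted
    have := preservesColimitsOfShape_forget A hM J
    have : PreservesColimitsOfShape J L := adj.leftAdjoint_preservesColimits.1
    exact inferInstanceAs (PreservesColimitsOfShape J (L ⋙ forget A M))

/-- The criterion is applied to the evaluations at all objects of `A` rather than to `forget`. Their
targets are locally presentable by hypothesis, so functor categories need not be shown to be so. -/
theorem isLocallyPresentable : IsLocallyPresentable.{w} (LaxMor A M) := by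
  have := hM.hasColimitsOfSize
  have := hM.locallyPresentable
  have := hasColimitsOfShape_walkingReflexivePair A hM
  have := preservesColimitsOfShape_walkingReflexivePair_forget A hM
  have : HasColimitsOfSize.{w, w} (LaxMor A M) := ⟨fun J _ => by
    have : HasColimitsOfShape J (∀ i, A.obj i ⥤ M.obj i) :=
      ⟨fun D => pi.hasColimit_of_hasColimit_comp_eval⟩
    exact (freeAdjunction A hM).hasColimitsOfShape_of_reflexiveCoequalizers J⟩
  have (k : (i : C) × A.obj i) : (value A M k.1 k.2).IsRightAdjoint := by
    have := (freeAdjunction A hM).isRightAdjoint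
    have := Pi.isRightAdjoint_eval (B := fun i => A.obj i ⥤ M.obj i) k.1
    exact inferInstanceAs (forget A M ⋙ Pi.eval _ k.1 ⋙ (evaluation _ _).obj k.2).IsRightAdjoint
  have (k : (i : C) × A.obj i) :
      PreservesFilteredColimitsOfSize.{w, w} (value A M k.1 k.2) := ⟨fun J _ _ => by
    have : IsSifted J := IsFiltered.isSifted
    exact preservesColimitsOfShape_value A hM J k.1 k.2⟩
  exact isLocallyPresentable_of_isRightAdjoint (fun k : (i : C) × A.obj i => value A M k.1 k.2)
    (fun f g h => hom_ext fun i c => h ⟨i, c⟩)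
    (fun f h => isIso_of_isIso_value f fun i c => h ⟨i, c⟩)

end LocallyPresentable

end LaxMor

end CatOperad

theorem mainTheorem7 {C : Type w} (O : CatOperad.{w, w, w} C)
    (A : CatOperad.Algebra.{w, w, w, w, w} O) (M : CatOperad.Algebra.{w, w, w, u, w} O)
    (hM : M.IsLocallyPresentable) :
    IsLocallyPresentable.{w} (CatOperad.LaxMor A M) ∧
      ∃ (L : (∀ i, A.obj i ⥤ M.obj i) ⥤ CatOperad.LaxMor A M)
        (adj : L ⊣ CatOperad.LaxMor.forget A M),
        (Monad.comparison adj).IsEquivalence ∧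
          PreservesFilteredColimitsOfSize.{w, w} adj.toMonad.toFunctor := by
  have := hM.hasColimitsOfSize
  exact ⟨CatOperad.LaxMor.isLocallyPresentable hM, _, CatOperad.LaxMor.freeAdjunction A hM,
    CatOperad.LaxMor.isEquivalence_comparison hM _,
    CatOperad.LaxMor.preservesFilteredColimits_toMonad hM _⟩
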